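/- Let $\mathfrak o$ and $\mathfrak o'$ be compact discrete valuation rings, that is, discrete valuation rings that are compact in the topology defined by the powers of their maximal ideals $\wp$ and $\wp'$, respectively. Suppose that the residue fields $\mathfrak o/\wp$ and $\mathfrak o'/\wp'$ are isomorphic and that their order is even, that $\mathfrak o$ has characteristic $0$ and ramification index $\mathrm e$, where $\mathrm e$ is defined by $2\mathfrak o=\wp^{\mathrm e}$, and that $\mathfrak o'$ has characteristic $2$. For $m\ge 1$ write $\mathfrak o_m=\mathfrak o/\wp^m$ and $\mathfrak o'_m=\mathfrak o'/\wp'^m$. Then for every integer $r>\mathrm e$ the group algebras $\mathbb C[\mathrm{SL}_2(\mathfrak o_{2r})]$ and $\mathbb C[\mathrm{SL}_2(\mathfrak o'_{2r})]$ are not isomorphic as $\mathbb C$-algebras. -/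

import Mathlib

/-! Let R be either quotient ring, of length 2r with uniformizer π and residue field k, G = SL₂(R),
and B its upper triangular subgroup. The algebra ℂ[G] determines how many irreducible
representations have dimension at least [G : B]. The proof shows that these are exactly the
principal series Ind χ from B, with χ a character of Rˣ that is primitive (nontrivial on 1 +
(π^(2r-1))) and satisfies χ ≠ χ⁻¹; the only coincidences are Ind χ ≅ Ind χ⁻¹. So their number is
half that of the primitive χ with χ ≠ χ⁻¹.

The number of all primitive characters depends only on |k| and |Rˣ|, hence is the same on both
sides. In characteristic 0 with r > e every element of 1 + (π^(2r-1)) is a square, so no primitive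
character is its own inverse. In characteristic 2 the unit 1 + π^(2r-1) is not a square, so some
primitive character is quadratic. The two counts therefore differ.

Irreducibility of Ind χ is a Mackey computation with the idempotent of χ
(`SL2.principalIdem_isMinimal`, `SL2.principalIdem_not_isMinimal`). Completeness of the list is
`SL2.exists_primitive_borel_eigenvector`, by Clifford theory. The congruence subgroup modulo π^r is
abelian and its characters come from matrices A. Remove the largest power π^i from A. If the rest
does not have two distinct eigenvalues in k, its centralizer acts on an eigenspace through commuting
operators and has more elements than B, so the dimension is below [G : B]. If it has two, A is
diagonalised modulo π and Fourier averaging yields a B-eigenvector: its character is primitive when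
i = 0, and when i > 0 the dimension is again too small.

Everything is phrased with idempotents, and the transfer along an algebra isomorphism is a double
count (`SL2.card_primitiveChar_le`). -/

/-! ### Idempotents of linear characters and dimension bounds -/

open MonoidAlgebra in
/-- The idempotent of the group algebra attached to a linear character of a subgroup. -/
noncomputable def charIdem {G : Type*} [Group G] [Finite G] (H : Subgroup G) (lam : H →* ℂˣ) :
    MonoidAlgebra ℂ G :=
  open Classical in
  MonoidAlgebra.ofCoeff (Finsupp.equivFunOnFinite.symm fun g =>
    if h : g ∈ H then (Nat.card H : ℂ)⁻¹ * ((lam ⟨g, h⟩)⁻¹ : ℂˣ) else 0)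

namespace charIdem

variable {G : Type*} [Group G] [Finite G] {H : Subgroup G} {lam : H →* ℂˣ}

theorem coeff_of_mem {g : G} (h : g ∈ H) :
    (charIdem H lam).coeff g = (Nat.card H : ℂ)⁻¹ * ((lam ⟨g, h⟩)⁻¹ : ℂˣ) := by
  simp [charIdem, h]

theorem coeff_of_notMem {g : G} (h : g ∉ H) : (charIdem H lam).coeff g = 0 := by
  simp [charIdem, h]

theorem single_mul (h : H) :
    MonoidAlgebra.single (h : G) (1 : ℂ) * charIdem H lam = (lam h : ℂ) • charIdem H lam := by
  ext g
  rw [MonoidAlgebra.coeff_single_mul_apply, MonoidAlgebra.coeff_smul_apply]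
  by_cases hg : g ∈ H
  · have h1 : (h : G)⁻¹ * g ∈ H := H.mul_mem (H.inv_mem h.2) hg
    rw [coeff_of_mem hg, coeff_of_mem h1]
    have : (⟨(h : G)⁻¹ * g, h1⟩ : H) = h⁻¹ * ⟨g, hg⟩ := rfl
    rw [this]
    simp
    ring
  · have h1 : (h : G)⁻¹ * g ∉ H := fun h1 => hg (by simpa using H.mul_mem h.2 h1)
    rw [coeff_of_notMem hg, coeff_of_notMem h1]
    simp

theorem mul_single (h : H) :
    charIdem H lam * MonoidAlgebra.single (h : G) (1 : ℂ) = (lam h : ℂ) • charIdem H lam := by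
  ext g
  rw [MonoidAlgebra.coeff_mul_single_apply, MonoidAlgebra.coeff_smul_apply]
  by_cases hg : g ∈ H
  · have h1 : g * (h : G)⁻¹ ∈ H := H.mul_mem hg (H.inv_mem h.2)
    rw [coeff_of_mem hg, coeff_of_mem h1]
    have : (⟨g * (h : G)⁻¹, h1⟩ : H) = ⟨g, hg⟩ * h⁻¹ := rfl
    rw [this]
    simp
    ring
  · have h1 : g * (h : G)⁻¹ ∉ H := fun h1 => hg (by simpa using H.mul_mem h1 h.2)
    rw [coeff_of_notMem hg, coeff_of_notMem h1]
    simp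

theorem ne_zero : charIdem H lam ≠ 0 := by
  intro h
  have := coeff_of_mem (lam := lam) H.one_mem
  rw [h] at this
  have h1 : (⟨1, H.one_mem⟩ : H) = 1 := rfl
  rw [h1] at this
  simp [Nat.card_pos.ne', eq_comm] at this

end charIdem

theorem MonoidAlgebra.eq_sum_coeff_smul_single {G : Type*} [Fintype G] (x : MonoidAlgebra ℂ G) :
    x = ∑ g, x.coeff g • MonoidAlgebra.single g (1 : ℂ) := by
  classical
  ext g
  simp [MonoidAlgebra.coeff_sum]

/-- An `H`-eigenvector in a left ideal becomes a fixed point of the idempotent; this converts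
representation-theoretic eigenvectors into algebra. -/
theorem charIdem.mul_eq_self {G : Type*} [Group G] [Finite G] {H : Subgroup G} {lam : H →* ℂˣ}
    {x : MonoidAlgebra ℂ G}
    (hx : ∀ h : H, MonoidAlgebra.single (h : G) (1 : ℂ) * x = (lam h : ℂ) • x) :
    charIdem H lam * x = x := by
  classical
  have := Fintype.ofFinite G
  rw [MonoidAlgebra.eq_sum_coeff_smul_single (charIdem H lam), Finset.sum_mul]
  have key : ∀ g : G, ((charIdem H lam).coeff g • MonoidAlgebra.single g (1 : ℂ)) * x =
      (if g ∈ H then (Nat.card H : ℂ)⁻¹ else 0) • x := by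
    intro g
    by_cases hg : g ∈ H
    · rw [smul_mul_assoc, hx ⟨g, hg⟩, coeff_of_mem hg, smul_smul, if_pos hg]
      simp
    · rw [coeff_of_notMem hg, if_neg hg]
      simp
  rw [Finset.sum_congr rfl fun g _ => key g, ← Finset.sum_smul, Finset.sum_ite, Finset.sum_const,
    Finset.sum_const_zero, add_zero]
  have hc : (Finset.univ.filter (· ∈ H)).card = Nat.card H := by
    rw [Nat.card_eq_fintype_card, Fintype.card_subtype]
  rw [hc, nsmul_eq_mul, mul_inv_cancel₀, one_smul]
  exact_mod_cast Nat.card_pos.ne'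

theorem charIdem.mul_self {G : Type*} [Group G] [Finite G] {H : Subgroup G} {lam : H →* ℂˣ} :
    charIdem H lam * charIdem H lam = charIdem H lam :=
  charIdem.mul_eq_self charIdem.single_mul

/-- If two elements of the subgroups are intertwined by `g` but the characters disagree on them,
the corresponding Hecke product vanishes. -/
theorem charIdem.mul_single_mul_eq_zero {G : Type*} [Group G] [Finite G] {H H' : Subgroup G}
    {lam : H →* ℂˣ} {lam' : H' →* ℂˣ} {g : G} (h : H) (h' : H') (hg : (h : G) * g = g * h')
    (hne : lam h ≠ lam' h') :
    charIdem H lam * MonoidAlgebra.single g 1 * charIdem H' lam' = 0 := by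
  have h1 : charIdem H lam * MonoidAlgebra.single (h * g : G) 1 * charIdem H' lam' =
      (lam h : ℂ) • (charIdem H lam * MonoidAlgebra.single g 1 * charIdem H' lam') := by
    rw [← one_mul (1 : ℂ), ← MonoidAlgebra.single_mul_single, ← mul_assoc, charIdem.mul_single]
    simp
  have h2 : charIdem H lam * MonoidAlgebra.single (g * h' : G) 1 * charIdem H' lam' =
      (lam' h' : ℂ) • (charIdem H lam * MonoidAlgebra.single g 1 * charIdem H' lam') := by
    rw [← one_mul (1 : ℂ), ← MonoidAlgebra.single_mul_single, mul_assoc, mul_assoc,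
      charIdem.single_mul]
    simp [mul_assoc]
  rw [hg, h2] at h1
  rw [← sub_eq_zero, ← sub_smul, smul_eq_zero, sub_eq_zero] at h1
  rcases h1 with h1 | h1
  · exact absurd (Units.ext h1.symm) hne
  · exact h1

/-- A representation generated by a vector whose line is stable under `H` has dimension at most
the index of `H`. -/
theorem Representation.finrank_mul_card_le {G V : Type*} [Group G] [Finite G] [AddCommGroup V]
    [Module ℂ V] (ρ : Representation ℂ G V) (H : Subgroup G) (v : V)
    (hH : ∀ h ∈ H, ∃ c : ℂ, ρ h v = c • v)
    (hgen : Submodule.span ℂ (Set.range fun g => ρ g v) = ⊤) :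
    Module.finrank ℂ V * Nat.card H ≤ Nat.card G := by
  have := Fintype.ofFinite (G ⧸ H)
  have h1 : Submodule.span ℂ (Set.range fun q : G ⧸ H => ρ q.out v) = ⊤ := by
    rw [← top_le_iff, ← hgen, Submodule.span_le]
    rintro _ ⟨g, rfl⟩
    obtain ⟨h, hh⟩ := QuotientGroup.mk_out_eq_mul H g
    obtain ⟨c, hc⟩ := hH _ (H.inv_mem h.2)
    have : ρ g v = c • ρ (g : G ⧸ H).out v := by
      rw [← map_smul, ← hc, ← Module.End.mul_apply, ← map_mul, hh]
      simp
    simp only [SetLike.mem_coe]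
    rw [this]
    exact Submodule.smul_mem _ _ (Submodule.subset_span ⟨_, rfl⟩)
  have h2 : Module.finrank ℂ V ≤ Fintype.card (G ⧸ H) := by
    rw [← finrank_top ℂ V, ← h1]
    exact finrank_range_le_card _
  rw [H.card_eq_card_quotient_mul_card_subgroup, Nat.card_eq_fintype_card (α := G ⧸ H)]
  exact Nat.mul_le_mul_right _ h2

/-- The translates of the idempotent by coset representatives have disjoint supports, hence are
independent. -/
theorem charIdem.card_le_finrank_range {G : Type*} [Group G] [Finite G] (H : Subgroup G)
    (lam : H →* ℂˣ) :
    Nat.card G ≤ Module.finrank ℂ (LinearMap.range (LinearMap.mulRight ℂ (charIdem H lam))) *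
      Nat.card H := by
  classical
  have := Fintype.ofFinite (G ⧸ H)
  have := Fintype.ofFinite G
  rw [H.card_eq_card_quotient_mul_card_subgroup, Nat.card_eq_fintype_card (α := G ⧸ H)]
  refine Nat.mul_le_mul_right _ ?_
  let w : G ⧸ H → LinearMap.range (LinearMap.mulRight ℂ (charIdem H lam)) := fun q =>
    ⟨MonoidAlgebra.single q.out 1 * charIdem H lam, ⟨_, rfl⟩⟩
  have hfin : Module.Finite ℂ (MonoidAlgebra ℂ G) := inferInstance
  refine LinearIndependent.fintype_card_le_finrank (b := w) ?_
  rw [Fintype.linearIndependent_iff]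
  intro c hc q
  have h1 := congrArg (fun x : LinearMap.range (LinearMap.mulRight ℂ (charIdem H lam)) =>
    (x : MonoidAlgebra ℂ G).coeff q.out) hc
  simp only [w, Submodule.coe_sum, Submodule.coe_smul, MonoidAlgebra.coeff_sum,
    Finsupp.finsetSum_apply, MonoidAlgebra.coeff_smul_apply, ZeroMemClass.coe_zero,
    MonoidAlgebra.coeff_zero, Finsupp.coe_zero, Pi.zero_apply] at h1
  rw [Finset.sum_eq_single q] at h1
  · rw [MonoidAlgebra.coeff_single_mul_apply, inv_mul_cancel, coeff_of_mem H.one_mem] at h1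
    simpa using h1
  · intro q' _ hq
    rw [MonoidAlgebra.coeff_single_mul_apply, coeff_of_notMem]
    · simp
    · intro hmem
      apply hq
      rw [← QuotientGroup.out_eq' q', ← QuotientGroup.out_eq' q]
      exact QuotientGroup.eq.2 hmem
  · simp

/-! ### Minimal idempotents in semisimple algebras -/

/-- An idempotent `f` of a complex algebra whose corner `f A f` is spanned by `f`. -/
structure IsMinimalIdempotent {A : Type*} [Ring A] [Algebra ℂ A] (f : A) : Prop where
  idem : f * f = f
  ne_zero : f ≠ 0
  corner : ∀ a, ∃ c : ℂ, f * a * f = c • f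

/-- The left ideal of `x` is generated by an idempotent `e = a * x`; if `x * b * x` always vanished,
then `e = e * e` would be zero. -/
theorem IsSemisimpleRing.exists_mul_mul_ne_zero {A : Type*} [Ring A] [IsSemisimpleRing A] {x : A}
    (hx : x ≠ 0) : ∃ b, x * b * x ≠ 0 := by
  by_contra! h
  obtain ⟨e, he, hspan⟩ := IsSemisimpleRing.ideal_eq_span_idempotent (Ideal.span {x})
  have h1 : e ∈ Ideal.span {x} := hspan ▸ Ideal.mem_span_singleton_self e
  have h2 : x ∈ Ideal.span {e} := hspan ▸ Ideal.mem_span_singleton_self x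
  obtain ⟨a, rfl⟩ := Ideal.mem_span_singleton'.1 h1
  have h3 : a * x = 0 := by
    rw [← he.eq, mul_assoc, ← mul_assoc x, h a, mul_zero]
  rw [h3] at h2
  simp at h2
  exact hx h2

namespace IsMinimalIdempotent

variable {A : Type*} [Ring A] [Algebra ℂ A] {f : A}

/-- This is the simplicity of the left ideal `A f`. -/
theorem exists_mul_eq [IsSemisimpleRing A] (hf : IsMinimalIdempotent f) {x : A} (hx : x * f = x)
    (hx0 : x ≠ 0) : ∃ b, b * x = f := by
  obtain ⟨b, hb⟩ := IsSemisimpleRing.exists_mul_mul_ne_zero hx0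
  obtain ⟨c, hc⟩ := hf.corner (b * x)
  have hc0 : c ≠ 0 := by
    rintro rfl
    apply hb
    rw [zero_smul] at hc
    calc x * b * x = x * (f * (b * x) * f) := by
          rw [mul_assoc f, mul_assoc b, hx, ← mul_assoc x f, hx, mul_assoc]
      _ = 0 := by rw [hc, mul_zero]
  refine ⟨c⁻¹ • (f * b), ?_⟩
  rw [smul_mul_assoc, mul_assoc, ← hx, ← mul_assoc b, ← mul_assoc f, hc, smul_smul,
    inv_mul_cancel₀ hc0, one_smul]

/-- Right multiplication by `x` maps `A e` to the simple module `A f`. It is onto since `x ≠ 0`, and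
bijective by dimension, so `e` and `f` are equivalent idempotents. -/
theorem exists_inverse_of_finrank_le [IsSemisimpleRing A] [Module.Finite ℂ A]
    (hf : IsMinimalIdempotent f) {e x : A}
    (he : e * e = e) (hex : e * x = x) (hxf : x * f = x) (hx : x ≠ 0)
    (hdim : Module.finrank ℂ (LinearMap.range (LinearMap.mulRight ℂ e)) ≤
      Module.finrank ℂ (LinearMap.range (LinearMap.mulRight ℂ f))) :
    ∃ y, y * x = f ∧ x * y = e := by
  obtain ⟨b, hb⟩ := hf.exists_mul_eq hxf hx
  have hmap : ∀ a ∈ LinearMap.range (LinearMap.mulRight ℂ e), LinearMap.mulRight ℂ x a ∈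
      LinearMap.range (LinearMap.mulRight ℂ f) := by
    rintro _ ⟨a, rfl⟩
    refine ⟨a * x, ?_⟩
    simp only [LinearMap.mulRight_apply]
    rw [mul_assoc, hxf, mul_assoc, hex]
  let T := (LinearMap.mulRight ℂ x).restrict hmap
  have hsurj : Function.Surjective T := by
    rintro ⟨_, a, rfl⟩
    refine ⟨⟨a * b * e, ⟨a * b, rfl⟩⟩, ?_⟩
    ext1
    simp only [T, LinearMap.coe_restrict_apply, LinearMap.mulRight_apply]
    rw [mul_assoc, hex, mul_assoc, hb]
  have hinj : Function.Injective T := by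
    refine (LinearMap.injective_iff_surjective_of_finrank_eq_finrank (le_antisymm hdim ?_)).2 hsurj
    exact LinearMap.finrank_le_finrank_of_surjective hsurj
  refine ⟨b * e, by rw [mul_assoc, hex, hb], ?_⟩
  have h1 : T ⟨x * (b * e), ⟨x * b, by simp [mul_assoc]⟩⟩ = T ⟨e, ⟨e, by simp [he]⟩⟩ := by
    ext1
    simp only [T, LinearMap.coe_restrict_apply, LinearMap.mulRight_apply]
    rw [mul_assoc, mul_assoc b, hex, hb, hxf]
  exact congrArg Subtype.val (hinj h1)

theorem of_inverse (hf : IsMinimalIdempotent f) {e x y : A} (he : e * e = e) (hxf : x * f = x)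
    (hyx : y * x = f) (hxy : x * y = e) : IsMinimalIdempotent e where
  idem := he
  ne_zero := by
    rintro rfl
    apply hf.ne_zero
    rw [← hf.idem, ← hyx, mul_assoc, ← mul_assoc x, hxy, zero_mul, mul_zero]
  corner a := by
    obtain ⟨c, hc⟩ := hf.corner (y * a * x)
    refine ⟨c, ?_⟩
    have h1 : e * a * e = x * (f * (y * a * x) * f) * y := by
      rw [← hxy]
      nth_rewrite 1 [← hxf]
      nth_rewrite 2 [← hxf]
      simp only [mul_assoc]
    rw [h1, hc, mul_smul_comm, smul_mul_assoc, hxf, hxy]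

theorem map {A' : Type*} [Ring A'] [Algebra ℂ A'] (φ : A ≃ₐ[ℂ] A') (hf : IsMinimalIdempotent f) :
    IsMinimalIdempotent (φ f) where
  idem := by rw [← map_mul, hf.idem]
  ne_zero := by simpa using hf.ne_zero
  corner a := by
    obtain ⟨c, hc⟩ := hf.corner (φ.symm a)
    refine ⟨c, ?_⟩
    rw [← map_smul, ← hc]
    simp

end IsMinimalIdempotent

/-! ### Finite chain rings -/

/-- A finite chain ring of length `m` with uniformizer `π` and residue map `res`. -/
structure IsChainRing {R k : Type*} [CommRing R] [Field k] (res : R →+* k) (π : R) (m : ℕ) :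
    Prop where
  surjective : Function.Surjective res
  map_eq_zero_iff : ∀ x, res x = 0 ↔ π ∣ x
  isUnit : ∀ x, res x ≠ 0 → IsUnit x
  pow_eq_zero : π ^ m = 0
  pow_pred_ne_zero : π ^ (m - 1) ≠ 0

namespace IsChainRing

variable {R k : Type*} [CommRing R] [Field k] {res : R →+* k} {π : R} {m : ℕ}

theorem isUnit_iff (h : IsChainRing res π m) {x : R} : IsUnit x ↔ res x ≠ 0 :=
  ⟨fun hx => (hx.map res).ne_zero, h.isUnit x⟩

theorem pos (h : IsChainRing res π m) : 0 < m := by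
  rcases Nat.eq_zero_or_pos m with rfl | hm
  · exact absurd h.pow_eq_zero h.pow_pred_ne_zero
  · exact hm

theorem isUnit_or_dvd (h : IsChainRing res π m) (x : R) : IsUnit x ∨ π ∣ x := by
  by_cases hx : res x = 0
  · exact Or.inr ((h.map_eq_zero_iff x).1 hx)
  · exact Or.inl (h.isUnit x hx)

theorem not_isUnit (h : IsChainRing res π m) {x : R} (hx : π ∣ x) : ¬ IsUnit x := by
  rw [h.isUnit_iff, not_not, h.map_eq_zero_iff]
  exact hx

theorem pow_eq_zero_iff (h : IsChainRing res π m) {i : ℕ} : π ^ i = 0 ↔ m ≤ i := by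
  constructor
  · intro hi
    by_contra! hlt
    exact h.pow_pred_ne_zero (pow_eq_zero_of_le (by omega) hi)
  · intro hi
    exact pow_eq_zero_of_le hi h.pow_eq_zero

theorem pow_dvd_or (h : IsChainRing res π m) (x : R) (j : ℕ) :
    π ^ j ∣ x ∨ ∃ i < j, ∃ u : Rˣ, x = π ^ i * u := by
  induction j with
  | zero => simp
  | succ j ih =>
    rcases ih with ⟨y, rfl⟩ | ⟨i, hi, u, rfl⟩
    · rcases h.isUnit_or_dvd y with ⟨u, rfl⟩ | ⟨z, rfl⟩
      · exact Or.inr ⟨j, by omega, u, rfl⟩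
      · exact Or.inl ⟨z, by ring⟩
    · exact Or.inr ⟨i, by omega, u, rfl⟩

theorem exists_eq_pow_mul (h : IsChainRing res π m) {x : R} (hx : x ≠ 0) :
    ∃ i < m, ∃ u : Rˣ, x = π ^ i * u := by
  rcases h.pow_dvd_or x m with hd | hd
  · rw [h.pow_eq_zero, zero_dvd_iff] at hd
    exact absurd hd hx
  · exact hd

theorem dvd_pow_pred (h : IsChainRing res π m) {x : R} (hx : x ≠ 0) : x ∣ π ^ (m - 1) := by
  obtain ⟨i, hi, u, rfl⟩ := h.exists_eq_pow_mul hx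
  rw [Units.mul_right_dvd]
  exact pow_dvd_pow _ (by omega)

theorem pow_mul_eq_zero_iff (h : IsChainRing res π m) {i : ℕ} (hi : i ≤ m) {x : R} :
    π ^ i * x = 0 ↔ π ^ (m - i) ∣ x := by
  constructor
  · intro hx
    rcases h.pow_dvd_or x (m - i) with hd | ⟨j, hj, u, rfl⟩
    · exact hd
    · rw [← mul_assoc, ← pow_add, Units.mul_left_eq_zero, h.pow_eq_zero_iff] at hx
      omega
  · rintro ⟨y, rfl⟩
    rw [← mul_assoc, ← pow_add, Nat.add_sub_cancel' hi, h.pow_eq_zero, zero_mul]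

theorem nontrivial (h : IsChainRing res π m) : Nontrivial R :=
  ⟨⟨_, _, h.pow_pred_ne_zero⟩⟩

theorem card_mul_card_span_pow (h : IsChainRing res π m) {i : ℕ} (hi : i ≤ m) :
    Nat.card (Ideal.span {π ^ i}) * Nat.card (Ideal.span {π ^ (m - i)}) = Nat.card R := by
  let f : R →+ R := AddMonoidHom.mulLeft (π ^ i)
  have hker : Nat.card f.ker = Nat.card (Ideal.span {π ^ (m - i)}) := by
    refine Nat.card_congr (Equiv.subtypeEquivRight fun x => ?_)
    rw [AddMonoidHom.mem_ker, Ideal.mem_span_singleton]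
    exact h.pow_mul_eq_zero_iff hi
  have hrange : Nat.card f.range = Nat.card (Ideal.span {π ^ i}) := by
    refine Nat.card_congr (Equiv.subtypeEquivRight fun x => ?_)
    rw [AddMonoidHom.mem_range, Ideal.mem_span_singleton]
    exact exists_congr fun y => eq_comm
  rw [AddSubgroup.card_eq_card_quotient_mul_card_addSubgroup f.ker,
    Nat.card_congr (QuotientAddGroup.quotientKerEquivRange f).toEquiv, hker, hrange]

theorem card_mul_card_span (h : IsChainRing res π m) :
    Nat.card k * Nat.card (Ideal.span {π}) = Nat.card R := by
  have hker : Nat.card res.toAddMonoidHom.ker = Nat.card (Ideal.span {π}) := by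
    refine Nat.card_congr (Equiv.subtypeEquivRight fun x => ?_)
    rw [AddMonoidHom.mem_ker, Ideal.mem_span_singleton]
    exact h.map_eq_zero_iff x
  rw [AddSubgroup.card_eq_card_quotient_mul_card_addSubgroup res.toAddMonoidHom.ker, hker,
    Nat.card_congr (QuotientAddGroup.quotientKerEquivOfSurjective _ h.surjective).toEquiv]

theorem card_units_add [Finite R] (h : IsChainRing res π m) :
    Nat.card Rˣ + Nat.card (Ideal.span {π}) = Nat.card R := by
  classical
  have h1 : Nat.card Rˣ = Nat.card {x : R // IsUnit x} :=
    Nat.card_congr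
      { toFun := fun u => ⟨u, u.isUnit⟩
        invFun := fun x => x.2.unit
        left_inv := fun u => by ext; rfl
        right_inv := fun x => by ext; rfl }
  have h2 : Nat.card (Ideal.span {π}) = Nat.card {x : R // ¬ IsUnit x} := by
    refine Nat.card_congr (Equiv.subtypeEquivRight fun x => ?_)
    rw [Ideal.mem_span_singleton, h.isUnit_iff, not_not, h.map_eq_zero_iff]
  rw [h1, h2, ← Nat.card_sum]
  exact Nat.card_congr (Equiv.sumCompl _)

theorem card_mul_card_units [Finite R] (h : IsChainRing res π m) :
    Nat.card k * Nat.card Rˣ + Nat.card R = Nat.card k * Nat.card R := by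
  nth_rewrite 1 [← h.card_mul_card_span]
  rw [← mul_add, h.card_units_add]

theorem finite_residue [Finite R] (h : IsChainRing res π m) : Finite k :=
  Finite.of_surjective _ h.surjective

end IsChainRing

/-! ### Principal units and primitive characters -/

/-- The subgroup of units congruent to `1` modulo `a`. -/
def principalUnits {R : Type*} [CommRing R] (a : R) : Subgroup Rˣ where
  carrier := {u | a ∣ (u : R) - 1}
  one_mem' := by simp
  mul_mem' {u v} hu hv := by
    have : ((u * v : Rˣ) : R) - 1 = ((u : R) - 1) * v + ((v : R) - 1) := by push_cast; ring
    simp only [Set.mem_ofPred_eq] at *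
    rw [this]
    exact dvd_add (Dvd.dvd.mul_right hu _) hv
  inv_mem' {u} hu := by
    have : ((u⁻¹ : Rˣ) : R) - 1 = ((u : R) - 1) * (-(u⁻¹ : Rˣ)) := by
      rw [sub_mul, mul_neg, Units.mul_inv]; ring
    simp only [Set.mem_ofPred_eq] at *
    rw [this]
    exact Dvd.dvd.mul_right hu _

theorem mem_principalUnits {R : Type*} [CommRing R] {a : R} {u : Rˣ} :
    u ∈ principalUnits a ↔ a ∣ (u : R) - 1 := Iff.rfl

/-- A character of the unit group of a chain ring of length `m` is primitive if it is nontrivial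
on `1 + (π ^ (m - 1))`. -/
def IsPrimitiveChar {R : Type*} [CommRing R] (π : R) (m : ℕ) (χ : Rˣ →* ℂˣ) : Prop :=
  ∃ u ∈ principalUnits (π ^ (m - 1)), χ u ≠ 1

theorem IsPrimitiveChar.inv {R : Type*} [CommRing R] {π : R} {m : ℕ} {χ : Rˣ →* ℂˣ}
    (hχ : IsPrimitiveChar π m χ) : IsPrimitiveChar π m χ⁻¹ := by
  obtain ⟨u, hu, hne⟩ := hχ
  exact ⟨u, hu, by simpa using hne⟩

/-- If every element of `1 + (π ^ (m - 1))` is a square, a primitive character is not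
quadratic. -/
theorem IsPrimitiveChar.ne_inv {R : Type*} [CommRing R] {π : R} {m : ℕ} {χ : Rˣ →* ℂˣ}
    (hχ : IsPrimitiveChar π m χ) (hsq : ∀ u ∈ principalUnits (π ^ (m - 1)), IsSquare u) :
    χ ≠ χ⁻¹ := by
  intro h
  obtain ⟨u, hu, hne⟩ := hχ
  obtain ⟨v, rfl⟩ := hsq u hu
  apply hne
  rw [map_mul]
  nth_rewrite 1 [h]
  simp

/-- Characters of a finite abelian group separate `u` from the subgroup of squares, and a character
trivial on squares equals its inverse. -/
theorem IsPrimitiveChar.exists_eq_inv {R : Type*} [CommRing R] [Finite R] {π : R} {m : ℕ}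
    {u : Rˣ} (hu : u ∈ principalUnits (π ^ (m - 1))) (hsq : ¬ IsSquare u) :
    ∃ χ : Rˣ →* ℂˣ, IsPrimitiveChar π m χ ∧ χ = χ⁻¹ := by
  have h1 := (CommGroup.forall_monoidHom_apply_eq_one_iff ℂ (powMonoidHom 2 : Rˣ →* Rˣ).range u).not
  have h2 : u ∉ (powMonoidHom 2 : Rˣ →* Rˣ).range := by
    rintro ⟨v, rfl⟩
    exact hsq ⟨v, by simp [pow_two]⟩
  obtain ⟨χ, hχ⟩ := not_forall.1 (h1.2 h2)
  obtain ⟨hχ1, hχ2⟩ := Classical.not_imp.1 hχ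
  refine ⟨χ, ⟨u, hu, hχ2⟩, ?_⟩
  ext v : 1
  have := hχ1 (v ^ 2) ⟨v, rfl⟩
  rw [MonoidHom.inv_apply, eq_inv_iff_mul_eq_one, ← map_mul, ← pow_two, this]

/-- The imprimitive characters are those of the quotient by the last layer of units. -/
theorem card_primitiveChar_add {R : Type*} [CommRing R] [Finite R] (π : R) (m : ℕ) :
    Nat.card {χ : Rˣ →* ℂˣ // IsPrimitiveChar π m χ} +
      Nat.card (Rˣ ⧸ principalUnits (π ^ (m - 1))) = Nat.card Rˣ := by
  classical
  rw [← CommGroup.card_domRestrictHom_ker ℂ (principalUnits (π ^ (m - 1))),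
    ← CommGroup.card_monoidHom_of_hasEnoughRootsOfUnity Rˣ ℂ]
  have hfin : Finite (Rˣ →* ℂˣ) := inferInstance
  have h1 : Nat.card (MonoidHom.domRestrictHom (principalUnits (π ^ (m - 1))) ℂˣ).ker =
      Nat.card {χ : Rˣ →* ℂˣ // ¬ IsPrimitiveChar π m χ} := by
    refine Nat.card_congr (Equiv.subtypeEquivRight fun χ => ?_)
    rw [MonoidHom.mem_ker, MonoidHom.domRestrictHom_apply, MonoidHom.domRestrict_eq_one_iff]
    simp [IsPrimitiveChar]
  rw [h1, ← Nat.card_sum]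
  exact Nat.card_congr (Equiv.sumCompl _)

theorem IsChainRing.card_principalUnits {R k : Type*} [CommRing R] [Field k] {res : R →+* k} {π : R}
    {m : ℕ} [Finite R] (h : IsChainRing res π m) (hm : 2 ≤ m) :
    Nat.card (principalUnits (π ^ (m - 1))) = Nat.card k := by
  have h1 : Nat.card (principalUnits (π ^ (m - 1))) = Nat.card (Ideal.span {π ^ (m - 1)}) := by
    have hu : ∀ x : Ideal.span {π ^ (m - 1)}, IsUnit (1 + (x : R)) := fun x => by
      rw [h.isUnit_iff, map_add, map_one, (h.map_eq_zero_iff _).2, add_zero]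
      · exact one_ne_zero
      · exact (dvd_pow_self _ (by omega)).trans (Ideal.mem_span_singleton.1 x.2)
    exact Nat.card_congr
      { toFun := fun u => ⟨(u : Rˣ) - 1, Ideal.mem_span_singleton.2 u.2⟩
        invFun := fun x => ⟨(hu x).unit, by
          rw [mem_principalUnits]
          simpa using Ideal.mem_span_singleton.1 x.2⟩
        left_inv := fun u => by ext; simp
        right_inv := fun x => by ext; simp }
  have h2 := h.card_mul_card_span
  have h3 := h.card_mul_card_span_pow (i := m - 1) (by omega)
  rw [show m - (m - 1) = 1 by omega, pow_one, ← h2] at h3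
  rw [h1]
  exact Nat.eq_of_mul_eq_mul_right Nat.card_pos h3

/-- The last layer has as many elements as the residue field, so the number of primitive characters
depends only on the orders of `k` and `Rˣ`. -/
theorem IsChainRing.card_primitiveChar_mul_add {R k : Type*} [CommRing R] [Field k]
    {res : R →+* k} {π : R} {m : ℕ} [Finite R] (h : IsChainRing res π m) (hm : 2 ≤ m) :
    Nat.card {χ : Rˣ →* ℂˣ // IsPrimitiveChar π m χ} * Nat.card k + Nat.card Rˣ =
      Nat.card Rˣ * Nat.card k := by
  nth_rewrite 2 [← card_primitiveChar_add π m]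
  rw [add_mul, ← h.card_principalUnits hm, ← Subgroup.card_eq_card_quotient_mul_card_subgroup]

/-! ### The Borel subgroup and the principal series -/

namespace SL2

open Matrix

variable {R : Type*} [CommRing R]

theorem ext' {g h : SpecialLinearGroup (Fin 2) R} (h00 : g 0 0 = h 0 0) (h01 : g 0 1 = h 0 1)
    (h10 : g 1 0 = h 1 0) (h11 : g 1 1 = h 1 1) : g = h := by
  ext i j
  fin_cases i <;> fin_cases j <;> assumption

theorem mul_apply (g h : SpecialLinearGroup (Fin 2) R) (i j : Fin 2) :
    (g * h) i j = g i 0 * h 0 j + g i 1 * h 1 j := by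
  refine (congrFun (congrFun (Matrix.SpecialLinearGroup.coe_mul g h) i) j).trans ?_
  rw [Matrix.mul_apply, Fin.sum_univ_two]

theorem det_eq (g : SpecialLinearGroup (Fin 2) R) : g 0 0 * g 1 1 - g 0 1 * g 1 0 = 1 := by
  rw [← Matrix.det_fin_two, g.det_coe]

/-- The matrix with the given entries. -/
def mk (a b c d : R) (h : a * d - b * c = 1) : SpecialLinearGroup (Fin 2) R :=
  ⟨!![a, b; c, d], by rw [Matrix.det_fin_two_of, h]⟩

section
variable (a b c d : R) (h : a * d - b * c = 1)
@[simp] theorem mk_00 : (mk a b c d h) 0 0 = a := rfl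
@[simp] theorem mk_01 : (mk a b c d h) 0 1 = b := rfl
@[simp] theorem mk_10 : (mk a b c d h) 1 0 = c := rfl
@[simp] theorem mk_11 : (mk a b c d h) 1 1 = d := rfl
end

theorem inv_eq (g : SpecialLinearGroup (Fin 2) R) :
    g⁻¹ = mk (g 1 1) (-g 0 1) (-g 1 0) (g 0 0) (by linear_combination det_eq g) := by
  rw [inv_eq_iff_mul_eq_one]
  have := det_eq g
  apply ext' <;> simp [mul_apply] <;> first | ring1 | linear_combination this

@[simp] theorem inv_00 (g : SpecialLinearGroup (Fin 2) R) : g⁻¹ 0 0 = g 1 1 := by rw [inv_eq]; rfl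
@[simp] theorem inv_01 (g : SpecialLinearGroup (Fin 2) R) : g⁻¹ 0 1 = -g 0 1 := by rw [inv_eq]; rfl
@[simp] theorem inv_10 (g : SpecialLinearGroup (Fin 2) R) : g⁻¹ 1 0 = -g 1 0 := by rw [inv_eq]; rfl
@[simp] theorem inv_11 (g : SpecialLinearGroup (Fin 2) R) : g⁻¹ 1 1 = g 0 0 := by rw [inv_eq]; rfl

/-- The upper unipotent matrix. -/
def upper (b : R) : SpecialLinearGroup (Fin 2) R := mk 1 b 0 1 (by ring)

/-- The lower unipotent matrix. -/
def lower (c : R) : SpecialLinearGroup (Fin 2) R := mk 1 0 c 1 (by ring)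

/-- The diagonal matrix with entries `x` and `x⁻¹`. -/
def torus (x : Rˣ) : SpecialLinearGroup (Fin 2) R := mk x 0 0 (x⁻¹ : Rˣ) (by simp)

/-- The Weyl element. -/
def weyl : SpecialLinearGroup (Fin 2) R := mk 0 (-1) 1 0 (by ring)

theorem upper_add (b b' : R) : upper (b + b') = upper b * upper b' := by
  apply ext' <;> simp [mul_apply, upper, add_comm]

/-- The matrices with lower left entry divisible by `a`. -/
def lowerDvd (a : R) : Subgroup (SpecialLinearGroup (Fin 2) R) where
  carrier := {g | a ∣ g 1 0}
  one_mem' := by simp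
  mul_mem' {g h} hg hh := by
    simp only [Set.mem_ofPred_eq] at *
    rw [mul_apply]
    exact dvd_add (Dvd.dvd.mul_right hg _) (Dvd.dvd.mul_left hh _)
  inv_mem' {g} hg := by
    simp only [Set.mem_ofPred_eq] at *
    rw [inv_10]
    exact (dvd_neg).2 hg

theorem mem_lowerDvd {a : R} {g : SpecialLinearGroup (Fin 2) R} : g ∈ lowerDvd a ↔ a ∣ g 1 0 :=
  Iff.rfl

variable (R) in
/-- The upper triangular matrices. -/
def borel : Subgroup (SpecialLinearGroup (Fin 2) R) := lowerDvd 0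

theorem mem_borel {g : SpecialLinearGroup (Fin 2) R} : g ∈ borel R ↔ g 1 0 = 0 := by
  rw [borel, mem_lowerDvd, zero_dvd_iff]

/-- The upper left entry of an upper triangular matrix, as a unit. -/
def borelDiag : borel R →* Rˣ :=
  MonoidHom.toHomUnits
    { toFun := fun g => (g : SpecialLinearGroup (Fin 2) R) 0 0
      map_one' := by simp
      map_mul' := fun g h => by
        have := mem_borel.1 h.2
        simp [mul_apply, this] }

@[simp] theorem coe_borelDiag (g : borel R) :
    (borelDiag g : R) = (g : SpecialLinearGroup (Fin 2) R) 0 0 := rfl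

theorem card_borel : Nat.card (borel R) = Nat.card Rˣ * Nat.card R := by
  rw [← Nat.card_prod]
  refine Nat.card_congr
    { toFun := fun g => (borelDiag g, (g : SpecialLinearGroup (Fin 2) R) 0 1)
      invFun := fun p => ⟨mk p.1 p.2 0 (p.1⁻¹ : Rˣ) (by simp), mem_borel.2 rfl⟩
      left_inv := fun g => ?_
      right_inv := fun p => ?_ }
  · have h1 := mem_borel.1 g.2
    have h2 := det_eq (g : SpecialLinearGroup (Fin 2) R)
    rw [h1, mul_zero, sub_zero] at h2
    have h3 : ((borelDiag g)⁻¹ : Rˣ) = (g : SpecialLinearGroup (Fin 2) R) 1 1 :=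
      Units.inv_eq_of_mul_eq_one_right h2
    ext1
    apply ext'
    · rfl
    · rfl
    · exact h1.symm
    · exact h3
  · ext <;> rfl

/-- The inflation of a character of the unit group to the Borel subgroup. -/
def borelChar (χ : Rˣ →* ℂˣ) : borel R →* ℂˣ := χ.comp borelDiag

/-- On the big Bruhat cell, conjugation by `g` inverts the diagonal, as the Weyl element does. -/
theorem exists_isUnit_of_isUnit {x : R} (g : SpecialLinearGroup (Fin 2) R) (hx : IsUnit x)
    (hg : g 1 0 = x) (u : Rˣ) :
    ∃ h h' : borel R, (h : SpecialLinearGroup (Fin 2) R) * g = g * h' ∧ borelDiag h = u ∧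
      borelDiag h' = u⁻¹ := by
  obtain ⟨c, rfl⟩ := hx
  have hc : (c : R) * (c⁻¹ : Rˣ) = 1 := Units.mul_inv c
  refine ⟨⟨mk u (g 0 0 * (c⁻¹ : Rˣ) * ((u⁻¹ : Rˣ) - u)) 0 (u⁻¹ : Rˣ) (by simp), mem_borel.2 rfl⟩,
    ⟨mk (u⁻¹ : Rˣ) (g 1 1 * (c⁻¹ : Rˣ) * ((u⁻¹ : Rˣ) - u)) 0 u (by simp), mem_borel.2 rfl⟩, ?_, ?_, ?_⟩
  · apply ext' <;> simp only [mul_apply, mk_00, mk_01, mk_10, mk_11, hg]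
    · linear_combination (g 0 0 * ((u⁻¹ : Rˣ) - u)) * hc
    · ring
    · ring
    · linear_combination (-g 1 1 * ((u⁻¹ : Rˣ) - u)) * hc
  · ext; rfl
  · ext; rfl

variable [Finite R]

/-- The idempotent generating the principal series attached to `χ`. -/
noncomputable def principalIdem (χ : Rˣ →* ℂˣ) : MonoidAlgebra ℂ (SpecialLinearGroup (Fin 2) R) :=
  charIdem (borel R) (borelChar χ)

/-- Mackey's criterion on double cosets outside the Borel subgroup. The big cell can only intertwine
`χ` with `χ⁻¹`; the intermediate cells, where `g 1 0` is a nonzero nonunit, support nothing because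
`χ` is primitive. -/
theorem principalIdem_mul_single_mul_eq_zero {k : Type*} [Field k] {res : R →+* k} {π : R} {m : ℕ}
    (hR : IsChainRing res π m) {χ χ' : Rˣ →* ℂˣ} (hχ : IsPrimitiveChar π m χ) (hne : χ ≠ χ'⁻¹)
    {g : SpecialLinearGroup (Fin 2) R} (hg : g 1 0 ≠ 0) :
    principalIdem χ * MonoidAlgebra.single g 1 * principalIdem χ' = 0 := by
  rcases hR.isUnit_or_dvd (g 1 0) with hc | hc
  · obtain ⟨u, hu⟩ := DFunLike.ne_iff.1 hne
    obtain ⟨h, h', hgh, h1, h2⟩ := exists_isUnit_of_isUnit g hc rfl u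
    refine charIdem.mul_single_mul_eq_zero h h' hgh ?_
    simp only [borelChar, MonoidHom.comp_apply, h1, h2]
    simpa using hu
  · have ha : IsUnit (g 0 0) := by
      rcases hR.isUnit_or_dvd (g 0 0) with ha | ha
      · exact ha
      · refine absurd isUnit_one (hR.not_isUnit (x := 1) ?_)
        rw [← det_eq g]
        exact dvd_sub (Dvd.dvd.mul_right ha _) (Dvd.dvd.mul_left hc _)
    obtain ⟨a, ha⟩ := ha
    have haa : (a : R) * (a⁻¹ : Rˣ) = 1 := Units.mul_inv a
    obtain ⟨u, ⟨z, hz⟩, hu⟩ := hχ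
    obtain ⟨y, hy⟩ := hR.dvd_pow_pred hg
    obtain ⟨c', hc'⟩ := hc
    have hpow : π ^ (m - 1) * π = 0 := by
      rw [← pow_succ, Nat.sub_add_cancel hR.pos, hR.pow_eq_zero]
    -- Conjugating `upper t` by `g` gives the matrix `h` below, once `t * g 1 0 * g 1 0 = 0`. This
    -- `t` makes its diagonal entry the unit `u` on which `χ` is nontrivial, whereas `upper t` has
    -- diagonal 1.
    let t : R := -y * z * (a⁻¹ : Rˣ)
    have ht : t * g 1 0 * g 1 0 = 0 := by
      calc t * g 1 0 * g 1 0 = -(g 1 0 * y) * z * (a⁻¹ : Rˣ) * g 1 0 := by ring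
        _ = -(π ^ (m - 1) * π) * z * (a⁻¹ : Rˣ) * c' := by rw [← hy, hc']; ring
        _ = 0 := by rw [hpow]; ring
    have ht2 : 1 - t * g 0 0 * g 1 0 = u := by
      rw [← ha]
      linear_combination y * z * g 1 0 * haa - z * hy - hz
    have hdet := det_eq g
    let h : SpecialLinearGroup (Fin 2) R := mk (1 - t * g 0 0 * g 1 0) (t * g 0 0 * g 0 0) 0
      (1 + t * g 0 0 * g 1 0) (by linear_combination (- t * g 0 0 * g 0 0) * ht)
    let h' : SpecialLinearGroup (Fin 2) R := upper t
    refine charIdem.mul_single_mul_eq_zero ⟨h, mem_borel.2 rfl⟩ ⟨h', mem_borel.2 rfl⟩ ?_ ?_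
    · apply ext' <;> simp only [h, h', upper, mul_apply, mk_00, mk_01, mk_10, mk_11]
      · ring
      · linear_combination (t * g 0 0) * hdet
      · linear_combination g 0 0 * ht
      · linear_combination (t * g 1 0) * hdet + g 0 1 * ht
    · have e1 : borelDiag ⟨h, mem_borel.2 rfl⟩ = u := by
        ext
        exact ht2
      have e2 : borelDiag ⟨h', mem_borel.2 rfl⟩ = 1 := by
        ext
        rfl
      simp only [borelChar, MonoidHom.comp_apply, e1, e2, map_one]
      exact hu

theorem principalIdem_mul_single_mul_eq_zero_of_mem {χ χ' : Rˣ →* ℂˣ} (hne : χ ≠ χ')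
    {g : SpecialLinearGroup (Fin 2) R} (hg : g 1 0 = 0) :
    principalIdem χ * MonoidAlgebra.single g 1 * principalIdem χ' = 0 := by
  obtain ⟨u, hu⟩ := DFunLike.ne_iff.1 hne
  let h : borel R := ⟨torus u, mem_borel.2 rfl⟩
  let g' : borel R := ⟨g, mem_borel.2 hg⟩
  refine charIdem.mul_single_mul_eq_zero h (g'⁻¹ * h * g') ?_ ?_
  · simp [g', mul_assoc]
  · have e1 : borelDiag h = u := by ext; rfl
    simpa [borelChar, e1] using hu

theorem principalIdem_mul_mul_eq_zero {k : Type*} [Field k] {res : R →+* k} {π : R} {m : ℕ}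
    (hR : IsChainRing res π m) {χ χ' : Rˣ →* ℂˣ} (hχ : IsPrimitiveChar π m χ) (h1 : χ ≠ χ')
    (h2 : χ ≠ χ'⁻¹) (a : MonoidAlgebra ℂ (SpecialLinearGroup (Fin 2) R)) :
    principalIdem χ * a * principalIdem χ' = 0 := by
  have := Fintype.ofFinite (SpecialLinearGroup (Fin 2) R)
  rw [MonoidAlgebra.eq_sum_coeff_smul_single a, Finset.mul_sum, Finset.sum_mul]
  refine Finset.sum_eq_zero fun g _ => ?_
  rw [mul_smul_comm, smul_mul_assoc]
  by_cases hg : g 1 0 = 0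
  · rw [principalIdem_mul_single_mul_eq_zero_of_mem h1 hg, smul_zero]
  · rw [principalIdem_mul_single_mul_eq_zero hR hχ h2 hg, smul_zero]

theorem principalIdem_isMinimal {k : Type*} [Field k] {res : R →+* k} {π : R} {m : ℕ}
    (hR : IsChainRing res π m) {χ : Rˣ →* ℂˣ} (hχ : IsPrimitiveChar π m χ) (h2 : χ ≠ χ⁻¹) :
    IsMinimalIdempotent (principalIdem χ) where
  idem := charIdem.mul_self
  ne_zero := charIdem.ne_zero
  corner a := by
    have := Fintype.ofFinite (SpecialLinearGroup (Fin 2) R)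
    have key : ∀ g : SpecialLinearGroup (Fin 2) R, ∃ c : ℂ,
        principalIdem χ * MonoidAlgebra.single g 1 * principalIdem χ = c • principalIdem χ := by
      intro g
      by_cases hg : g 1 0 = 0
      · refine ⟨borelChar χ ⟨g, mem_borel.2 hg⟩, ?_⟩
        rw [principalIdem, charIdem.mul_single ⟨g, mem_borel.2 hg⟩, smul_mul_assoc,
          charIdem.mul_self]
      · exact ⟨0, by rw [principalIdem_mul_single_mul_eq_zero hR hχ h2 hg, zero_smul]⟩
    choose c hc using key
    refine ⟨∑ g, a.coeff g * c g, ?_⟩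
    nth_rewrite 1 [MonoidAlgebra.eq_sum_coeff_smul_single a]
    rw [Finset.mul_sum, Finset.sum_mul, Finset.sum_smul]
    refine Finset.sum_congr rfl fun g _ => ?_
    rw [mul_smul_comm, smul_mul_assoc, hc, smul_smul]

/-- All contributing terms come from elements of the Borel subgroup whose Weyl conjugate is again in
it; there the two characters cancel, so the sum counts such elements up to a positive factor. It
provides the link between the series of `χ` and of `χ⁻¹`. -/
theorem coeff_principalIdem_inv_mul_weyl_mul (χ : Rˣ →* ℂˣ) :
    (principalIdem χ⁻¹ * MonoidAlgebra.single weyl 1 * principalIdem χ).coeff weyl ≠ 0 := by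
  classical
  have := Fintype.ofFinite (SpecialLinearGroup (Fin 2) R)
  let P : SpecialLinearGroup (Fin 2) R → Prop := fun h => h ∈ borel R ∧ weyl⁻¹ * (h⁻¹ * weyl) ∈ borel R
  let n : ℂ := Nat.card (borel R)
  have hn : n ≠ 0 := by
    simp only [n]
    exact_mod_cast Nat.card_pos.ne'
  have key : ∀ h : SpecialLinearGroup (Fin 2) R, (principalIdem χ⁻¹).coeff h *
      (principalIdem χ).coeff (weyl⁻¹ * (h⁻¹ * weyl)) = if P h then n⁻¹ * n⁻¹ else 0 := by
    intro h
    by_cases h1 : h ∈ borel R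
    · by_cases h2 : weyl⁻¹ * (h⁻¹ * weyl) ∈ borel R
      · rw [if_pos ⟨h1, h2⟩, principalIdem, principalIdem, charIdem.coeff_of_mem h1,
          charIdem.coeff_of_mem h2]
        have e : borelDiag ⟨_, h2⟩ = borelDiag ⟨h, h1⟩ := by
          ext
          simp [mul_apply, weyl]
        simp only [borelChar, MonoidHom.comp_apply, e, MonoidHom.inv_apply, inv_inv]
        have : ((χ (borelDiag ⟨h, h1⟩) : ℂˣ) : ℂ) * ((χ (borelDiag ⟨h, h1⟩))⁻¹ : ℂˣ) = 1 :=
          Units.mul_inv _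
        linear_combination (n⁻¹ * n⁻¹) * this
      · rw [if_neg fun h => h2 h.2]
        rw [principalIdem, principalIdem, charIdem.coeff_of_notMem h2, mul_zero]
    · rw [if_neg fun h => h1 h.1]
      rw [principalIdem, charIdem.coeff_of_notMem h1, zero_mul]
  have hsum : (principalIdem χ⁻¹ * MonoidAlgebra.single weyl 1 * principalIdem χ).coeff weyl =
      ∑ h, (principalIdem χ⁻¹).coeff h * (principalIdem χ).coeff (weyl⁻¹ * (h⁻¹ * weyl)) := by
    conv_lhs => rw [mul_assoc, MonoidAlgebra.eq_sum_coeff_smul_single (principalIdem χ⁻¹),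
      Finset.sum_mul, MonoidAlgebra.coeff_sum, Finsupp.finsetSum_apply]
    refine Finset.sum_congr rfl fun h _ => ?_
    rw [smul_mul_assoc, MonoidAlgebra.coeff_smul_apply, MonoidAlgebra.coeff_single_mul_apply,
      MonoidAlgebra.coeff_single_mul_apply, one_mul, one_mul, smul_eq_mul]
  rw [hsum, Finset.sum_congr rfl fun h _ => key h, Finset.sum_ite, Finset.sum_const_zero, add_zero,
    Finset.sum_const, nsmul_eq_mul]
  refine mul_ne_zero ?_ (mul_ne_zero (inv_ne_zero hn) (inv_ne_zero hn))
  rw [Nat.cast_ne_zero, ← Nat.pos_iff_ne_zero, Finset.card_pos]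
  refine ⟨1, ?_⟩
  simp [P]

/-- For quadratic `χ` the Weyl element contributes to the corner an element not supported on the
Borel subgroup, hence not a multiple of the idempotent. -/
theorem principalIdem_not_isMinimal {χ : Rˣ →* ℂˣ} [Nontrivial R] (hχ : χ = χ⁻¹) :
    ¬ IsMinimalIdempotent (principalIdem χ) := by
  intro h
  obtain ⟨c, hc⟩ := h.corner (MonoidAlgebra.single weyl 1)
  have h1 := coeff_principalIdem_inv_mul_weyl_mul χ
  rw [← hχ, hc, MonoidAlgebra.coeff_smul_apply, principalIdem, charIdem.coeff_of_notMem] at h1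
  · simp at h1
  · rw [mem_borel]
    simp [weyl]

end SL2

/-! ### Common eigenvectors and primitive additive characters -/

/-- Commutation is required only on `W`: the centralizers used below need not be abelian, but they
act through commuting operators on an eigenspace. -/
theorem Module.End.exists_common_eigenvector {V ι : Type*} [AddCommGroup V] [Module ℂ V]
    [FiniteDimensional ℂ V] (f : ι → Module.End ℂ V) (W : Submodule ℂ V) (hW : W ≠ ⊥)
    (hmaps : ∀ i, ∀ w ∈ W, f i w ∈ W) (hcomm : ∀ i j, ∀ w ∈ W, f i (f j w) = f j (f i w)) :
    ∃ w ∈ W, w ≠ 0 ∧ ∀ i, ∃ c : ℂ, f i w = c • w := by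
  induction hn : Module.finrank ℂ W using Nat.strong_induction_on generalizing W with
  | _ n ih =>
    by_cases hall : ∀ i, ∃ c : ℂ, ∀ w ∈ W, f i w = c • w
    · obtain ⟨w, hw, hw0⟩ := Submodule.exists_mem_ne_zero_of_ne_bot hW
      exact ⟨w, hw, hw0, fun i => (hall i).imp fun c hc => hc w hw⟩
    · push Not at hall
      obtain ⟨i, hi⟩ := hall
      have : Nontrivial W := Submodule.nontrivial_iff_ne_bot.2 hW
      obtain ⟨c, hc⟩ := Module.End.exists_eigenvalue ((f i).restrict (hmaps i))
      obtain ⟨w, hw⟩ := hc.exists_hasEigenvector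
      let W' : Submodule ℂ V := W ⊓ LinearMap.ker (f i - c • LinearMap.id)
      have hmem : ∀ x, x ∈ W' ↔ x ∈ W ∧ f i x = c • x := by
        intro x
        simp [W', sub_eq_zero]
      have hwW' : (w : V) ∈ W' := by
        rw [hmem]
        refine ⟨w.2, ?_⟩
        simpa using congrArg Subtype.val hw.apply_eq_smul
      have hW' : W' ≠ ⊥ := by
        intro h
        rw [h, Submodule.mem_bot] at hwW'
        exact hw.2 (Subtype.ext hwW')
      have hlt : W' < W := by
        refine lt_of_le_of_ne inf_le_left fun h => ?_
        obtain ⟨x, hx, hne⟩ := hi c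
        rw [← h, hmem] at hx
        exact hne hx.2
      obtain ⟨x, hx, hx0, hx1⟩ := ih (Module.finrank ℂ W')
        (hn ▸ Submodule.finrank_lt_finrank_of_lt hlt) W' hW'
        (fun j x hx => by
          rw [hmem] at hx ⊢
          exact ⟨hmaps j x hx.1, by rw [hcomm i j x hx.1, hx.2, map_smul]⟩)
        (fun j j' x hx => hcomm j j' x ((hmem x).1 hx).1) rfl
      exact ⟨x, ((hmem x).1 hx).1, hx0, hx1⟩

/-- Every nonzero ideal contains `π ^ (m - 1)`, so a character nontrivial there is nontrivial on all
of them. -/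
theorem IsChainRing.exists_isPrimitive {R k : Type*} [CommRing R] [Field k] {res : R →+* k} {π : R}
    {m : ℕ} [Finite R] (h : IsChainRing res π m) : ∃ ψ : AddChar R ℂ, ψ.IsPrimitive := by
  obtain ⟨ψ, hψ⟩ := AddChar.exists_apply_ne_zero.2 h.pow_pred_ne_zero
  refine ⟨ψ, fun a ha h1 => hψ ?_⟩
  obtain ⟨y, hy⟩ := h.dvd_pow_pred ha
  have := DFunLike.congr_fun h1 y
  rwa [AddChar.mulShift_apply, ← hy, AddChar.one_apply] at this

theorem AddChar.IsPrimitive.exists_mulShift_eq {R : Type*} [CommRing R] [Finite R]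
    {ψ : AddChar R ℂ} (hψ : ψ.IsPrimitive) (η : AddChar R ℂ) : ∃ a, ψ.mulShift a = η := by
  have := Fintype.ofFinite R
  have hbij : Function.Bijective ψ.mulShift :=
    (Fintype.bijective_iff_injective_and_card _).2
      ⟨AddChar.to_mulShift_inj_of_isPrimitive hψ, AddChar.card_eq.symm⟩
  exact hbij.2 η

theorem AddChar.IsPrimitive.eq_zero {R : Type*} [CommRing R]
    {ψ : AddChar R ℂ} (hψ : ψ.IsPrimitive) {a : R} (h : ∀ y, ψ (a * y) = 1) : a = 0 := by
  by_contra ha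
  exact hψ ha (by ext y; simpa using h y)

/-! ### Congruence subgroups and their characters -/

namespace SL2

open Matrix

variable {R : Type*} [CommRing R]

/-- The matrices congruent to `1` modulo `a`. -/
def congruence (a : R) : Subgroup (SpecialLinearGroup (Fin 2) R) where
  carrier := {g | a ∣ g 0 0 - 1 ∧ a ∣ g 0 1 ∧ a ∣ g 1 0 ∧ a ∣ g 1 1 - 1}
  one_mem' := by simp
  mul_mem' {g h} hg hh := by
    obtain ⟨⟨x, hx⟩, ⟨y, hy⟩, ⟨z, hz⟩, ⟨w, hw⟩⟩ := hg
    obtain ⟨⟨x', hx'⟩, ⟨y', hy'⟩, ⟨z', hz'⟩, ⟨w', hw'⟩⟩ := hh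
    simp only [Set.mem_ofPred_eq, mul_apply]
    rw [sub_eq_iff_eq_add] at hx hw hx' hw'
    rw [hx, hy, hz, hw, hx', hy', hz', hw']
    refine ⟨⟨a * x * x' + x + x' + a * y * z', by ring⟩, ⟨a * x * y' + y' + a * y * w' + y, by ring⟩,
      ⟨a * z * x' + z + a * w * z' + z', by ring⟩, ⟨a * z * y' + a * w * w' + w + w', by ring⟩⟩
  inv_mem' {g} hg := by
    simp only [Set.mem_ofPred_eq, inv_00, inv_01, inv_10, inv_11, dvd_neg] at *
    exact ⟨hg.2.2.2, hg.2.1, hg.2.2.1, hg.1⟩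

theorem mem_congruence {a : R} {g : SpecialLinearGroup (Fin 2) R} :
    g ∈ congruence a ↔ a ∣ g 0 0 - 1 ∧ a ∣ g 0 1 ∧ a ∣ g 1 0 ∧ a ∣ g 1 1 - 1 := Iff.rfl

theorem conj_mem_congruence {a : R} {g : SpecialLinearGroup (Fin 2) R} (hg : g ∈ congruence a)
    (h : SpecialLinearGroup (Fin 2) R) : h⁻¹ * g * h ∈ congruence a := by
  obtain ⟨⟨x, hx⟩, ⟨y, hy⟩, ⟨z, hz⟩, ⟨w, hw⟩⟩ := hg
  have hd := det_eq h
  rw [sub_eq_iff_eq_add] at hx hw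
  simp only [mem_congruence, mul_apply, inv_00, inv_01, inv_10, inv_11, hx, hy, hz, hw]
  refine ⟨⟨h 1 1 * x * h 0 0 - h 0 1 * z * h 0 0 + (h 1 1 * y * h 1 0 - h 0 1 * w * h 1 0), ?_⟩,
    ⟨h 1 1 * x * h 0 1 - h 0 1 * z * h 0 1 + (h 1 1 * y * h 1 1 - h 0 1 * w * h 1 1), by ring⟩,
    ⟨-h 1 0 * x * h 0 0 + h 0 0 * z * h 0 0 + (-h 1 0 * y * h 1 0 + h 0 0 * w * h 1 0), by ring⟩,
    ⟨-h 1 0 * x * h 0 1 + h 0 0 * z * h 0 1 + (-h 1 0 * y * h 1 1 + h 0 0 * w * h 1 1), ?_⟩⟩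
  · linear_combination hd
  · linear_combination hd

theorem congruence_le {a b : R} (h : a ∣ b) : congruence b ≤ congruence a := fun _ hg =>
  ⟨h.trans hg.1, h.trans hg.2.1, h.trans hg.2.2.1, h.trans hg.2.2.2⟩

theorem upper_mem_congruence {a b : R} (h : a ∣ b) : upper b ∈ congruence a := by
  simp [mem_congruence, upper, h]

theorem lower_mem_congruence {a b : R} (h : a ∣ b) : lower b ∈ congruence a := by
  simp [mem_congruence, lower, h]

theorem mul_comm_of_mem_congruence {a : R} (ha : a * a = 0) {g h : SpecialLinearGroup (Fin 2) R}
    (hg : g ∈ congruence a) (hh : h ∈ congruence a) : g * h = h * g := by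
  obtain ⟨⟨x, hx⟩, ⟨y, hy⟩, ⟨z, hz⟩, ⟨w, hw⟩⟩ := hg
  obtain ⟨⟨x', hx'⟩, ⟨y', hy'⟩, ⟨z', hz'⟩, ⟨w', hw'⟩⟩ := hh
  rw [sub_eq_iff_eq_add] at hx hw hx' hw'
  apply ext' <;> simp only [mul_apply, hx, hy, hz, hw, hx', hy', hz', hw']
  · linear_combination (y * z' - y' * z) * ha
  · linear_combination (x * y' + y * w' - x' * y - y' * w) * ha
  · linear_combination (z * x' + w * z' - z' * x - w' * z) * ha
  · linear_combination (z * y' - z' * y) * ha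

/-- A simultaneous eigenvector of the abelian congruence subgroup determines a linear form. -/
theorem exists_linear_form [Finite R] {a : R} (ha : ∀ z : R, a * z = 0 ↔ a ∣ z) {ψ : AddChar R ℂ}
    (hψ : ψ.IsPrimitive) {V : Type*} [AddCommGroup V] [Module ℂ V]
    (ρ : Representation ℂ (SpecialLinearGroup (Fin 2) R) V) {v : V} (hv : v ≠ 0)
    (heig : ∀ g ∈ congruence a, ∃ c : ℂ, ρ g v = c • v) :
    ∃ p s t : R, ∀ g ∈ congruence a,
      ρ g v = ψ (p * (g 0 0 - 1) + s * g 0 1 + t * g 1 0) • v := by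
  have haa : a * a = 0 := (ha a).2 dvd_rfl
  -- Along a one-parameter family the eigenvalue is an additive character `ψ (α * y)`. Triviality on
  -- multiples of `a` gives `a * α = 0`, so `α` is a multiple of `a` by `ha`.
  have main : ∀ e : R → SpecialLinearGroup (Fin 2) R, (∀ y, e y ∈ congruence a) →
      (∀ y z, e (y + z) = e y * e z) → e 0 = 1 → (∀ y, e (a * y) = 1) →
      ∃ α, ∀ y, ρ (e y) v = ψ (α * (a * y)) • v := by
    intro e he hadd he0 hea
    choose c hc using fun y => heig (e y) (he y)
    let η : AddChar R ℂ :=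
      { toFun := c
        map_zero_eq_one' := by
          have := hc 0
          rw [he0, map_one, Module.End.one_apply] at this
          nth_rewrite 1 [← one_smul ℂ v] at this
          exact (smul_left_injective ℂ hv this).symm
        map_add_eq_mul' := fun y z => by
          have := hc (y + z)
          rw [hadd, map_mul, Module.End.mul_apply, hc z, map_smul, hc y, smul_smul] at this
          rw [mul_comm]
          exact (smul_left_injective ℂ hv this).symm }
    obtain ⟨α, hα⟩ := hψ.exists_mulShift_eq η
    have hα' : ∀ y, ψ (α * y) = c y := fun y => DFunLike.congr_fun hα y
    have h1 : a * α = 0 := by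
      refine hψ.eq_zero fun y => ?_
      rw [show a * α * y = α * (a * y) by ring, hα']
      have := hc (a * y)
      rw [hea, map_one, Module.End.one_apply] at this
      nth_rewrite 1 [← one_smul ℂ v] at this
      exact (smul_left_injective ℂ hv this).symm
    obtain ⟨β, rfl⟩ := (ha α).1 h1
    refine ⟨β, fun y => ?_⟩
    rw [hc, ← hα']
    congr 2
    ring
  have hdiag : ∀ y : R, (1 + a * y) * (1 - a * y) - 0 * 0 = 1 := fun y => by
    linear_combination (-y * y) * haa
  obtain ⟨s, hs⟩ := main (fun y => upper (a * y)) (fun y => upper_mem_congruence (dvd_mul_right _ _))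
    (fun y z => by rw [mul_add, upper_add]) (by apply ext' <;> simp [upper])
    (fun y => by rw [← mul_assoc, haa]; apply ext' <;> simp [upper])
  obtain ⟨t, ht⟩ := main (fun y => lower (a * y)) (fun y => lower_mem_congruence (dvd_mul_right _ _))
    (fun y z => by apply ext' <;> simp [lower, mul_apply]; ring) (by apply ext' <;> simp [lower])
    (fun y => by rw [← mul_assoc, haa]; apply ext' <;> simp [lower])
  obtain ⟨p, hp⟩ := main (fun y => mk (1 + a * y) 0 0 (1 - a * y) (hdiag y))
    (fun y => by simp [mem_congruence])
    (fun y z => by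
      apply ext' <;> simp [mul_apply]
      · linear_combination (-y * z) * haa
      · linear_combination (-y * z) * haa)
    (by apply ext' <;> simp)
    (fun y => by apply ext' <;> simp [← mul_assoc, haa])
  refine ⟨p, s, t, fun g hg => ?_⟩
  obtain ⟨⟨x, hx⟩, ⟨y, hy⟩, ⟨z, hz⟩, ⟨w, hw⟩⟩ := hg
  have hd := det_eq g
  rw [sub_eq_iff_eq_add] at hx hw
  -- Since `a * a = 0`, the determinant forces the lower right entry to be `1 - a * x`, so three
  -- coefficients describe the character.
  have hg : g = upper (a * y) * (lower (a * z) * mk (1 + a * x) 0 0 (1 - a * x) (hdiag x)) := by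
    apply ext' <;> simp only [mul_apply, upper, lower, mk_00, mk_01, mk_10, mk_11, hx, hy, hz, hw]
    · linear_combination (-y * z * (1 + a * x)) * haa
    · linear_combination (y * x) * haa
    · linear_combination (-z * x) * haa
    · rw [hx, hy, hz, hw] at hd
      linear_combination hd - (x * w - y * z) * haa
  have hx' : g 0 0 - 1 = a * x := by rw [hx]; ring
  nth_rewrite 1 [hg]
  rw [map_mul, map_mul, Module.End.mul_apply, Module.End.mul_apply, hp, map_smul, ht, map_smul,
    map_smul, hs, smul_smul, smul_smul, hx', hy, hz, AddChar.map_add_eq_mul,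
    AddChar.map_add_eq_mul]
  congr 1
  ring

end SL2

/-! ### Centralizers and stabilizers of characters -/

namespace SL2

open Matrix

variable {R : Type*} [CommRing R]

/-- The determinant one matrices commuting with `A` modulo the annihilator of `a`. -/
def centralizerMod (a : R) (A : Matrix (Fin 2) (Fin 2) R) :
    Subgroup (SpecialLinearGroup (Fin 2) R) where
  carrier := {g | a • ((g : Matrix (Fin 2) (Fin 2) R) * A) = a • (A * g)}
  one_mem' := by simp
  mul_mem' {g h} hg hh := by
    simp only [Set.mem_ofPred_eq, Matrix.SpecialLinearGroup.coe_mul] at *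
    rw [mul_assoc, ← mul_smul_comm, hh, mul_smul_comm, ← mul_assoc, ← smul_mul_assoc, hg,
      smul_mul_assoc, mul_assoc]
  inv_mem' {g} hg := by
    simp only [Set.mem_ofPred_eq] at *
    have h1 : (g : Matrix (Fin 2) (Fin 2) R) * (g⁻¹ : SpecialLinearGroup (Fin 2) R) = 1 := by
      rw [← Matrix.SpecialLinearGroup.coe_mul, mul_inv_cancel, Matrix.SpecialLinearGroup.coe_one]
    have h2 : ((g⁻¹ : SpecialLinearGroup (Fin 2) R) : Matrix (Fin 2) (Fin 2) R) * g = 1 := by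
      rw [← Matrix.SpecialLinearGroup.coe_mul, inv_mul_cancel, Matrix.SpecialLinearGroup.coe_one]
    calc a • (((g⁻¹ : SpecialLinearGroup (Fin 2) R) : Matrix (Fin 2) (Fin 2) R) * A)
        = (g⁻¹ : SpecialLinearGroup (Fin 2) R) * (a • (A * g)) * (g⁻¹ : SpecialLinearGroup (Fin 2) R) := by
          rw [mul_smul_comm, smul_mul_assoc, mul_assoc, mul_assoc, h1, mul_one]
      _ = a • (A * (g⁻¹ : SpecialLinearGroup (Fin 2) R)) := by
          rw [← hg, mul_smul_comm, smul_mul_assoc, ← mul_assoc, h2, one_mul]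

theorem mem_centralizerMod {a : R} {A : Matrix (Fin 2) (Fin 2) R}
    {g : SpecialLinearGroup (Fin 2) R} :
    g ∈ centralizerMod a A ↔ a • ((g : Matrix (Fin 2) (Fin 2) R) * A) = a • (A * g) := Iff.rfl

/-- The matrix has lower right entry 0, so a unit among `p`, `s`, `t` makes it nonscalar modulo the
maximal ideal when the ring is local. The commutant of such a matrix consists of polynomials in it;
the unit entry supplies the coefficient `y`. -/
theorem exists_eq_add_of_mem_centralizerMod {a : R} (ha : ∀ z : R, a * z = 0 ↔ a ∣ z) {p s t : R}
    (hpst : IsUnit p ∨ IsUnit s ∨ IsUnit t) {g : SpecialLinearGroup (Fin 2) R}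
    (hg : g ∈ centralizerMod a !![p, t; s, 0]) :
    ∃ (x y : R) (X : Matrix (Fin 2) (Fin 2) R),
      (g : Matrix (Fin 2) (Fin 2) R) = x • 1 + y • !![p, t; s, 0] + a • X := by
  rw [mem_centralizerMod] at hg
  have e00 := congrFun (congrFun hg 0) 0
  have e01 := congrFun (congrFun hg 0) 1
  have e10 := congrFun (congrFun hg 1) 0
  simp only [Matrix.smul_apply, Matrix.mul_apply, Fin.sum_univ_two, smul_eq_mul, Matrix.of_apply,
    Matrix.cons_val', Matrix.cons_val_zero, Matrix.cons_val_one, Matrix.cons_val_fin_one]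
    at e00 e01 e10
  have key : ∃ y, a * (g 0 0 - g 1 1 - y * p) = 0 ∧ a * (g 0 1 - y * t) = 0 ∧
      a * (g 1 0 - y * s) = 0 := by
    rcases hpst with ⟨u, rfl⟩ | ⟨u, rfl⟩ | ⟨u, rfl⟩
    · have hu : (u : R) * (u⁻¹ : Rˣ) = 1 := Units.mul_inv u
      refine ⟨(g 0 0 - g 1 1) * (u⁻¹ : Rˣ), ?_, ?_, ?_⟩
      · linear_combination (-a * (g 0 0 - g 1 1)) * hu
      · linear_combination (-(u⁻¹ : Rˣ) : R) * e01 - (a * g 0 1) * hu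
      · linear_combination ((u⁻¹ : Rˣ) : R) * e10 - (a * g 1 0) * hu
    · have hu : (u : R) * (u⁻¹ : Rˣ) = 1 := Units.mul_inv u
      refine ⟨g 1 0 * (u⁻¹ : Rˣ), ?_, ?_, ?_⟩
      · linear_combination (-(u⁻¹ : Rˣ) : R) * e10 - (a * (g 0 0 - g 1 1)) * hu
      · linear_combination ((u⁻¹ : Rˣ) : R) * e00 - (a * g 0 1) * hu
      · linear_combination (-a * g 1 0) * hu
    · have hu : (u : R) * (u⁻¹ : Rˣ) = 1 := Units.mul_inv u
      refine ⟨g 0 1 * (u⁻¹ : Rˣ), ?_, ?_, ?_⟩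
      · linear_combination ((u⁻¹ : Rˣ) : R) * e01 - (a * (g 0 0 - g 1 1)) * hu
      · linear_combination (-a * g 0 1) * hu
      · linear_combination (-(u⁻¹ : Rˣ) : R) * e00 - (a * g 1 0) * hu
  obtain ⟨y, h1, h2, h3⟩ := key
  rw [ha] at h1 h2 h3
  obtain ⟨x1, hx1⟩ := h1
  obtain ⟨x2, hx2⟩ := h2
  obtain ⟨x3, hx3⟩ := h3
  refine ⟨g 1 1, y, !![x1, x2; x3, 0], ?_⟩
  ext i j
  fin_cases i <;> fin_cases j <;> simp
  · linear_combination hx1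
  · linear_combination hx2
  · linear_combination hx3

theorem coe_mul_coe_inv (g : SpecialLinearGroup (Fin 2) R) :
    (g : Matrix (Fin 2) (Fin 2) R) * ((g⁻¹ : SpecialLinearGroup (Fin 2) R) : Matrix _ _ R) = 1 := by
  rw [← Matrix.SpecialLinearGroup.coe_mul, mul_inv_cancel, Matrix.SpecialLinearGroup.coe_one]

theorem coe_inv_mul_coe (g : SpecialLinearGroup (Fin 2) R) :
    ((g⁻¹ : SpecialLinearGroup (Fin 2) R) : Matrix _ _ R) * (g : Matrix (Fin 2) (Fin 2) R) = 1 := by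
  rw [← Matrix.SpecialLinearGroup.coe_mul, inv_mul_cancel, Matrix.SpecialLinearGroup.coe_one]

theorem mem_congruence_iff_exists {a : R} {g : SpecialLinearGroup (Fin 2) R} :
    g ∈ congruence a ↔ ∃ X, (g : Matrix (Fin 2) (Fin 2) R) = 1 + a • X := by
  constructor
  · rintro ⟨⟨x, hx⟩, ⟨y, hy⟩, ⟨z, hz⟩, ⟨w, hw⟩⟩
    refine ⟨!![x, y; z, w], ?_⟩
    ext i j
    fin_cases i <;> fin_cases j <;> simp
    · linear_combination hx
    · exact hy
    · exact hz
    · linear_combination hw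
  · rintro ⟨X, hX⟩
    have h := fun i j => congrFun (congrFun hX i) j
    simp [mem_congruence, h]

theorem trace_mul_sub_one (p s t : R) (g : SpecialLinearGroup (Fin 2) R) :
    trace (!![p, t; s, 0] * ((g : Matrix (Fin 2) (Fin 2) R) - 1)) =
      p * (g 0 0 - 1) + s * g 0 1 + t * g 1 0 := by
  simp only [Matrix.trace_fin_two, Matrix.mul_apply, Fin.sum_univ_two, Matrix.of_apply,
    Matrix.cons_val', Matrix.cons_val_zero, Matrix.cons_val_one, Matrix.cons_val_fin_one,
    Matrix.sub_apply, Matrix.one_apply_eq, Matrix.one_apply_ne zero_ne_one,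
    Matrix.one_apply_ne one_ne_zero]
  ring

/-- By cyclicity of the trace, the centralizer fixes the character of the congruence subgroup
attached to `A`. -/
theorem trace_conj_of_mem_centralizerMod {a : R} {A : Matrix (Fin 2) (Fin 2) R}
    {g h : SpecialLinearGroup (Fin 2) R} (hg : g ∈ congruence a) (hh : h ∈ centralizerMod a A) :
    trace (A * (((h⁻¹ * g * h : SpecialLinearGroup (Fin 2) R) : Matrix (Fin 2) (Fin 2) R) - 1)) =
      trace (A * ((g : Matrix (Fin 2) (Fin 2) R) - 1)) := by
  obtain ⟨X, hX⟩ := mem_congruence_iff_exists.1 hg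
  set H : Matrix (Fin 2) (Fin 2) R := (h : Matrix (Fin 2) (Fin 2) R)
  set Hi : Matrix (Fin 2) (Fin 2) R :=
    ((h⁻¹ : SpecialLinearGroup (Fin 2) R) : Matrix (Fin 2) (Fin 2) R)
  have h1 : H * Hi = 1 := coe_mul_coe_inv h
  have h2 : Hi * H = 1 := coe_inv_mul_coe h
  have h3 : ((h⁻¹ * g * h : SpecialLinearGroup (Fin 2) R) : Matrix (Fin 2) (Fin 2) R) - 1 =
      Hi * (a • X) * H := by
    rw [Matrix.SpecialLinearGroup.coe_mul, Matrix.SpecialLinearGroup.coe_mul, hX, mul_add, add_mul,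
      mul_one, h2, add_sub_cancel_left]
  calc trace (A * (((h⁻¹ * g * h : SpecialLinearGroup (Fin 2) R) : Matrix (Fin 2) (Fin 2) R) - 1))
      = trace (a • (H * A) * Hi * X) := by
        rw [h3, ← mul_assoc, trace_mul_comm]
        simp only [smul_mul_assoc, mul_smul_comm, mul_assoc]
    _ = trace (A * ((g : Matrix (Fin 2) (Fin 2) R) - 1)) := by
        rw [mem_centralizerMod.1 hh, hX, add_sub_cancel_left, smul_mul_assoc, smul_mul_assoc,
          mul_assoc A, h1, mul_one, mul_smul_comm]

/-- Modulo `a` both elements are polynomials in `A`, so their commutator is in the congruence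
subgroup; cyclicity of the trace shows that the character of `A` is trivial on it. -/
theorem commutator_mem_and_trace {a : R} (haa : a * a = 0) {A : Matrix (Fin 2) (Fin 2) R}
    {g h : SpecialLinearGroup (Fin 2) R} {x y x' y' : R} {X X' : Matrix (Fin 2) (Fin 2) R}
    (hg : (g : Matrix (Fin 2) (Fin 2) R) = x • 1 + y • A + a • X)
    (hh : (h : Matrix (Fin 2) (Fin 2) R) = x' • 1 + y' • A + a • X')
    (hg' : g ∈ centralizerMod a A) (hh' : h ∈ centralizerMod a A) :
    (h * g)⁻¹ * (g * h) ∈ congruence a ∧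
      trace (A * ((((h * g)⁻¹ * (g * h) : SpecialLinearGroup (Fin 2) R) :
        Matrix (Fin 2) (Fin 2) R) - 1)) = 0 := by
  have hcomm : (g : Matrix (Fin 2) (Fin 2) R) * h - h * g =
      a • (y • (A * X' - X' * A) + y' • (X * A - A * X)) := by
    have key : (g : Matrix (Fin 2) (Fin 2) R) * h - h * g =
        a • (y • (A * X' - X' * A) + y' • (X * A - A * X)) + (a * a) • (X * X' - X' * X) := by
      rw [hg, hh]
      simp only [add_mul, mul_add, smul_mul_assoc, mul_smul_comm, one_mul, mul_one]
      module
    rw [key, haa, zero_smul, add_zero]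
  set D : Matrix (Fin 2) (Fin 2) R :=
    (((h * g)⁻¹ : SpecialLinearGroup (Fin 2) R) : Matrix (Fin 2) (Fin 2) R) with hD
  have hD' : a • (D * A) = a • (A * D) := by
    have := (centralizerMod a A).inv_mem ((centralizerMod a A).mul_mem hh' hg')
    exact mem_centralizerMod.1 this
  have hk : (((h * g)⁻¹ * (g * h) : SpecialLinearGroup (Fin 2) R) : Matrix (Fin 2) (Fin 2) R) =
      1 + a • (D * (y • (A * X' - X' * A) + y' • (X * A - A * X))) := by
    rw [← mul_smul_comm, ← hcomm, mul_sub, ← Matrix.SpecialLinearGroup.coe_mul h g, hD, coe_inv_mul_coe,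
      add_sub_cancel, Matrix.SpecialLinearGroup.coe_mul, Matrix.SpecialLinearGroup.coe_mul g h]
  refine ⟨mem_congruence_iff_exists.2 ⟨_, hk⟩, ?_⟩
  have htr : ∀ Y : Matrix (Fin 2) (Fin 2) R, a * trace (A * (D * (A * Y))) =
      a * trace (A * (D * (Y * A))) := by
    intro Y
    have h1 : trace (A * (D * (Y * A))) = trace (A * (A * D) * Y) := by
      rw [show A * (D * (Y * A)) = A * D * Y * A by simp only [mul_assoc], trace_mul_comm]
      simp only [mul_assoc]
    have h2 : A * (D * (A * Y)) = A * (D * A) * Y := by simp only [mul_assoc]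
    have h3 : a • (A * (D * A) * Y) = a • (A * (A * D) * Y) := by
      rw [← smul_mul_assoc, ← mul_smul_comm, hD', mul_smul_comm, smul_mul_assoc]
    rw [h1, h2]
    simpa using congrArg trace h3
  rw [hk, add_sub_cancel_left, mul_smul_comm, trace_smul, smul_eq_mul]
  simp only [mul_add, mul_sub, mul_smul_comm, trace_add, trace_sub, trace_smul, smul_eq_mul]
  linear_combination y * htr X' - y' * htr X

end SL2

/-! ### The case without two distinct eigenvalues -/

namespace SL2

open Matrix

variable {R : Type*} [CommRing R]

/-- The invertible matrices commuting with `A` modulo the annihilator of `a`. -/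
def unitCentralizerMod (a : R) (A : Matrix (Fin 2) (Fin 2) R) :
    Subgroup (Matrix (Fin 2) (Fin 2) R)ˣ where
  carrier := {g | a • ((g : Matrix (Fin 2) (Fin 2) R) * A) = a • (A * g)}
  one_mem' := by simp
  mul_mem' {g h} hg hh := by
    simp only [Set.mem_ofPred_eq, Units.val_mul] at *
    rw [mul_assoc, ← mul_smul_comm, hh, mul_smul_comm, ← mul_assoc, ← smul_mul_assoc, hg,
      smul_mul_assoc, mul_assoc]
  inv_mem' {g} hg := by
    simp only [Set.mem_ofPred_eq] at *
    calc a • ((g⁻¹ : (Matrix (Fin 2) (Fin 2) R)ˣ) * A)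
        = (g⁻¹ : (Matrix (Fin 2) (Fin 2) R)ˣ) * (a • (A * g)) *
            ((g⁻¹ : (Matrix (Fin 2) (Fin 2) R)ˣ) : Matrix (Fin 2) (Fin 2) R) := by
          rw [mul_smul_comm, smul_mul_assoc, mul_assoc, mul_assoc, Units.mul_inv, mul_one]
      _ = a • (A * (g⁻¹ : (Matrix (Fin 2) (Fin 2) R)ˣ)) := by
          rw [← hg, mul_smul_comm, smul_mul_assoc, ← mul_assoc, Units.inv_mul, one_mul]

theorem mem_unitCentralizerMod {a : R} {A : Matrix (Fin 2) (Fin 2) R}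
    {g : (Matrix (Fin 2) (Fin 2) R)ˣ} :
    g ∈ unitCentralizerMod a A ↔ a • ((g : Matrix (Fin 2) (Fin 2) R) * A) = a • (A * g) := Iff.rfl

theorem card_unitCentralizerMod_le [Finite R] (a : R) (A : Matrix (Fin 2) (Fin 2) R) :
    Nat.card (unitCentralizerMod a A) ≤ Nat.card Rˣ * Nat.card (centralizerMod a A) := by
  let f : unitCentralizerMod a A →* Rˣ :=
    (Units.map (Matrix.detMonoidHom (n := Fin 2) (R := R))).comp (Subgroup.subtype _)
  rw [Subgroup.card_eq_card_quotient_mul_card_subgroup f.ker]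
  refine Nat.mul_le_mul ?_ ?_
  · exact Nat.card_le_card_of_injective _ (QuotientGroup.kerLift_injective f)
  · have hdet : ∀ g : f.ker, (((g : unitCentralizerMod a A) : (Matrix (Fin 2) (Fin 2) R)ˣ) :
        Matrix (Fin 2) (Fin 2) R).det = 1 :=
      fun g => congrArg Units.val g.2
    refine Nat.card_le_card_of_injective (fun g : f.ker =>
      (⟨⟨_, hdet g⟩, (g : unitCentralizerMod a A).2⟩ : centralizerMod a A)) ?_
    intro g g' h
    apply Subtype.ext
    apply Subtype.ext
    apply Units.ext
    exact congrArg (fun x : centralizerMod a A =>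
      ((x : SpecialLinearGroup (Fin 2) R) : Matrix (Fin 2) (Fin 2) R)) h

/-- The form in `hN` is the determinant of `x + y A`. Its residual zeros lie on the line `x + l y =
0`, so `x = u - l y` with `u` a unit gives an invertible matrix. Perturbing the entries by multiples
of `a` affects neither invertibility nor commutation after scaling by `a`. -/
theorem exists_mem_unitCentralizerMod {k : Type*} [Field k] {res : R →+* k} {π : R} {m : ℕ}
    (hR : IsChainRing res π m) {a : R} (ha : ∀ z : R, a * z = 0 ↔ a ∣ z) (hπ : π ∣ a) {p s t l : R}
    (hN : ∀ x y : R, res (x * x + p * x * y - s * t * (y * y)) = 0 → res (x + l * y) = 0)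
    (u : Rˣ) (y : R) {e f g h : R} (he : a ∣ e) (hf : a ∣ f) (hg : a ∣ g) (hh : a ∣ h) :
    ∃ M ∈ unitCentralizerMod a !![p, t; s, 0], (M : Matrix (Fin 2) (Fin 2) R) =
      !![u - l * y + y * p + e, y * t + f; y * s + g, u - l * y + h] := by
  set M : Matrix (Fin 2) (Fin 2) R :=
    !![u - l * y + y * p + e, y * t + f; y * s + g, u - l * y + h] with hM
  have hz : ∀ {z : R}, a ∣ z → res z = 0 := fun hz => (hR.map_eq_zero_iff _).2 (hπ.trans hz)
  have hdet : IsUnit M.det := by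
    rw [hR.isUnit_iff, hM, Matrix.det_fin_two_of]
    intro h0
    have h1 := hN (u - l * y) y (by
      rw [← h0]
      simp only [map_sub, map_add, map_mul, hz he, hz hf, hz hg, hz hh]
      ring)
    rw [sub_add_cancel] at h1
    exact (hR.isUnit_iff.1 u.isUnit) h1
  have hM' : IsUnit M := (Matrix.isUnit_iff_isUnit_det _).2 hdet
  refine ⟨hM'.unit, ?_, rfl⟩
  rw [mem_unitCentralizerMod, IsUnit.unit_spec]
  have he := (ha e).2 he
  have hf := (ha f).2 hf
  have hg := (ha g).2 hg
  have hh := (ha h).2 hh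
  ext i j
  fin_cases i <;> fin_cases j <;>
    simp only [Matrix.smul_apply, Matrix.mul_apply, Fin.sum_univ_two, smul_eq_mul, Matrix.of_apply,
      Matrix.cons_val', Matrix.cons_val_zero, Matrix.cons_val_one, Matrix.cons_val_fin_one, hM,
      Fin.zero_eta, Fin.mk_one]
  · linear_combination s * hf - t * hg
  · linear_combination t * he - p * hf - t * hh
  · linear_combination p * hg + s * hh - s * he
  · linear_combination t * hg - s * hf

/-- The parameters are `u`, `y` and two perturbations in `I = (π ^ r)`, where `|I|² = |R|`. The
perturbed entries are chosen away from those from which `u` and `y` are recovered, according to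
which of `p`, `s`, `t` is a unit. Passing to determinant one costs at most a factor `|Rˣ|`. -/
theorem card_pow_le_card_centralizerMod {k : Type*} [Field k] {res : R →+* k} {π : R} {r : ℕ}
    [Finite R] (hR : IsChainRing res π (2 * r)) {p s t l : R}
    (hN : ∀ x y : R, res (x * x + p * x * y - s * t * (y * y)) = 0 → res (x + l * y) = 0)
    (hpst : IsUnit p ∨ IsUnit s ∨ IsUnit t) :
    Nat.card R * Nat.card R ≤ Nat.card (centralizerMod (π ^ r) !![p, t; s, 0]) := by
  have hr := hR.pos
  have ha : ∀ z : R, π ^ r * z = 0 ↔ π ^ r ∣ z := fun z => by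
    rw [hR.pow_mul_eq_zero_iff (by omega), show 2 * r - r = r by omega]
  have hπ : π ∣ π ^ r := dvd_pow_self _ (by omega)
  have hI := hR.card_mul_card_span_pow (i := r) (by omega)
  rw [show 2 * r - r = r by omega] at hI
  set I := Ideal.span {π ^ r}
  have hmem : ∀ z : I, π ^ r ∣ (z : R) := fun z => Ideal.mem_span_singleton.1 z.2
  have hle : Nat.card (Rˣ × R × I × I) ≤ Nat.card (unitCentralizerMod (π ^ r) !![p, t; s, 0]) := by
    rcases hpst with hp | hs | ht
    · choose F hF hF' using fun z : Rˣ × R × I × I => exists_mem_unitCentralizerMod hR ha hπ hN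
        z.1 z.2.1 (dvd_zero _) (hmem z.2.2.1) (hmem z.2.2.2) (dvd_zero _)
      refine Nat.card_le_card_of_injective (fun z => (⟨F z, hF z⟩ : unitCentralizerMod _ _)) ?_
      rintro ⟨u, y, z, w⟩ ⟨u', y', z', w'⟩ h
      have h := congrArg (fun x : unitCentralizerMod (π ^ r) !![p, t; s, 0] =>
        ((x : (Matrix (Fin 2) (Fin 2) R)ˣ) : Matrix (Fin 2) (Fin 2) R)) h
      simp only [hF'] at h
      have h00 := congrFun (congrFun h 0) 0
      have h01 := congrFun (congrFun h 0) 1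
      have h10 := congrFun (congrFun h 1) 0
      have h11 := congrFun (congrFun h 1) 1
      simp only [Matrix.of_apply, Matrix.cons_val', Matrix.cons_val_zero, Matrix.cons_val_one,
        Matrix.cons_val_fin_one, add_zero] at h00 h01 h10 h11
      have hy : y = y' := by
        apply hp.mul_right_cancel
        linear_combination h00 - h11
      subst hy
      have hu : u = u' := by
        ext
        linear_combination h11
      have hz : z = z' := by
        ext
        linear_combination h01
      have hw : w = w' := by
        ext
        linear_combination h10
      rw [hu, hz, hw]
    · choose F hF hF' using fun z : Rˣ × R × I × I => exists_mem_unitCentralizerMod hR ha hπ hN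
        z.1 z.2.1 (dvd_zero _) (hmem z.2.2.1) (dvd_zero _) (hmem z.2.2.2)
      refine Nat.card_le_card_of_injective (fun z => (⟨F z, hF z⟩ : unitCentralizerMod _ _)) ?_
      rintro ⟨u, y, z, w⟩ ⟨u', y', z', w'⟩ h
      have h := congrArg (fun x : unitCentralizerMod (π ^ r) !![p, t; s, 0] =>
        ((x : (Matrix (Fin 2) (Fin 2) R)ˣ) : Matrix (Fin 2) (Fin 2) R)) h
      simp only [hF'] at h
      have h00 := congrFun (congrFun h 0) 0
      have h01 := congrFun (congrFun h 0) 1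
      have h10 := congrFun (congrFun h 1) 0
      have h11 := congrFun (congrFun h 1) 1
      simp only [Matrix.of_apply, Matrix.cons_val', Matrix.cons_val_zero, Matrix.cons_val_one,
        Matrix.cons_val_fin_one, add_zero] at h00 h01 h10 h11
      have hy : y = y' := hs.mul_right_cancel h10
      subst hy
      have hu : u = u' := by
        ext
        linear_combination h00
      subst hu
      have hz : z = z' := by
        ext
        linear_combination h01
      have hw : w = w' := by
        ext
        linear_combination h11
      rw [hz, hw]
    · choose F hF hF' using fun z : Rˣ × R × I × I => exists_mem_unitCentralizerMod hR ha hπ hN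
        z.1 z.2.1 (dvd_zero _) (dvd_zero _) (hmem z.2.2.1) (hmem z.2.2.2)
      refine Nat.card_le_card_of_injective (fun z => (⟨F z, hF z⟩ : unitCentralizerMod _ _)) ?_
      rintro ⟨u, y, z, w⟩ ⟨u', y', z', w'⟩ h
      have h := congrArg (fun x : unitCentralizerMod (π ^ r) !![p, t; s, 0] =>
        ((x : (Matrix (Fin 2) (Fin 2) R)ˣ) : Matrix (Fin 2) (Fin 2) R)) h
      simp only [hF'] at h
      have h00 := congrFun (congrFun h 0) 0
      have h01 := congrFun (congrFun h 0) 1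
      have h10 := congrFun (congrFun h 1) 0
      have h11 := congrFun (congrFun h 1) 1
      simp only [Matrix.of_apply, Matrix.cons_val', Matrix.cons_val_zero, Matrix.cons_val_one,
        Matrix.cons_val_fin_one, add_zero] at h00 h01 h10 h11
      have hy : y = y' := ht.mul_right_cancel h01
      subst hy
      have hu : u = u' := by
        ext
        linear_combination h00
      subst hu
      have hz : z = z' := by
        ext
        linear_combination h10
      have hw : w = w' := by
        ext
        linear_combination h11
      rw [hz, hw]
  rw [Nat.card_prod, Nat.card_prod, Nat.card_prod, hI] at hle
  exact Nat.le_of_mul_le_mul_left (hle.trans (card_unitCentralizerMod_le _ _)) Nat.card_pos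

theorem card_borel_lt [Finite R] {k : Type*} [Field k] {res : R →+* k} {π : R} {m : ℕ}
    (hR : IsChainRing res π m) : Nat.card (borel R) < Nat.card R * Nat.card R := by
  rw [card_borel]
  refine Nat.mul_lt_mul_of_pos_right ?_ (Nat.card_pos (α := R))
  have h1 := hR.card_units_add
  have h2 : 0 < Nat.card (Ideal.span {π}) := Nat.card_pos
  omega

/-- If the reduction of `!![p, t; s, 0]` does not have two distinct eigenvalues, a representation
containing the corresponding character of the congruence subgroup has small dimension. -/
theorem finrank_mul_card_borel_lt [Finite R] {k : Type*} [Field k] {res : R →+* k} {π : R} {r : ℕ}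
    (hR : IsChainRing res π (2 * r)) {p s t l : R}
    (hN : ∀ x y : R, res (x * x + p * x * y - s * t * (y * y)) = 0 → res (x + l * y) = 0)
    (hpst : IsUnit p ∨ IsUnit s ∨ IsUnit t) {ψ : AddChar R ℂ} (b : R)
    {V : Type*} [AddCommGroup V] [Module ℂ V] [FiniteDimensional ℂ V]
    (ρ : Representation ℂ (SpecialLinearGroup (Fin 2) R) V)
    (hgen : ∀ v ≠ 0, Submodule.span ℂ (Set.range fun g => ρ g v) = ⊤) {v : V} (hv : v ≠ 0)
    (heig : ∀ g ∈ congruence (π ^ r),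
      ρ g v = ψ (b * (p * (g 0 0 - 1) + s * g 0 1 + t * g 1 0)) • v) :
    Module.finrank ℂ V * Nat.card (borel R) < Nat.card (SpecialLinearGroup (Fin 2) R) := by
  have hr := hR.pos
  have ha : ∀ z : R, π ^ r * z = 0 ↔ π ^ r ∣ z := fun z => by
    rw [hR.pow_mul_eq_zero_iff (by omega), show 2 * r - r = r by omega]
  have haa := (ha _).2 dvd_rfl
  set A : Matrix (Fin 2) (Fin 2) R := !![p, t; s, 0] with hA
  let θ : SpecialLinearGroup (Fin 2) R → ℂ := fun g =>
    ψ (b * trace (A * ((g : Matrix (Fin 2) (Fin 2) R) - 1)))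
  let W : Submodule ℂ V :=
    { carrier := {w | ∀ g ∈ congruence (π ^ r), ρ g w = θ g • w}
      zero_mem' := by simp
      add_mem' := fun {x y} hx hy g hg => by rw [map_add, hx g hg, hy g hg, smul_add]
      smul_mem' := fun c x hx g hg => by rw [map_smul, hx g hg, smul_comm] }
  have hvW : v ∈ W := fun g hg => by
    rw [heig g hg, ← trace_mul_sub_one]
  have hmaps : ∀ h : centralizerMod (π ^ r) A, ∀ w ∈ W, ρ h w ∈ W := by
    intro h w hw g hg
    have h1 : ρ g (ρ h w) = ρ h (ρ ((h : SpecialLinearGroup (Fin 2) R)⁻¹ * g * h) w) := by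
      simp only [← Module.End.mul_apply, ← map_mul]
      congr 2
      group
    rw [h1, hw _ (conj_mem_congruence hg h), map_smul]
    simp only [θ]
    rw [trace_conj_of_mem_centralizerMod hg h.2]
  -- The commutator lies in the congruence subgroup and its character value is 1, so it fixes every
  -- vector of `W`.
  have hcomm : ∀ h h' : centralizerMod (π ^ r) A, ∀ w ∈ W, ρ h (ρ h' w) = ρ h' (ρ h w) := by
    intro h h' w hw
    obtain ⟨x, y, X, hX⟩ := exists_eq_add_of_mem_centralizerMod ha hpst h.2
    obtain ⟨x', y', X', hX'⟩ := exists_eq_add_of_mem_centralizerMod ha hpst h'.2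
    obtain ⟨h1, h2⟩ := commutator_mem_and_trace haa hX hX' h.2 h'.2
    have h3 := hw _ h1
    simp only [θ] at h3
    rw [h2, mul_zero, AddChar.map_zero_eq_one, one_smul] at h3
    nth_rewrite 2 [← h3]
    simp only [← Module.End.mul_apply, ← map_mul]
    congr 2
    group
  obtain ⟨w, hwW, hw0, hw⟩ := Module.End.exists_common_eigenvector
    (fun h : centralizerMod (π ^ r) A => ρ h) W (fun h => hv (by simpa [h] using hvW)) hmaps hcomm
  have h1 := ρ.finrank_mul_card_le (centralizerMod (π ^ r) A) w (fun h hh => hw ⟨h, hh⟩)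
    (hgen w hw0)
  have : Nontrivial V := ⟨⟨_, _, hv⟩⟩
  refine lt_of_lt_of_le ?_ h1
  exact Nat.mul_lt_mul_of_pos_left
    ((card_borel_lt hR).trans_le (card_pow_le_card_centralizerMod hR hN hpst)) Module.finrank_pos

end SL2

/-! ### The split case: producing Borel eigenvectors -/

namespace SL2

open Matrix

variable {R : Type*} [CommRing R]

/-- An additive character of level exactly `l`. -/
structure IsLevel (π : R) (l : ℕ) (Φ : AddChar R ℂ) : Prop where
  eq_one : ∀ z, π ^ l ∣ z → Φ z = 1
  dvd : ∀ β, (∀ γ, Φ (π ^ (l - 1) * β * γ) = 1) → π ∣ β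

theorem conj_00_sub_dvd {a b : R} {g h : SpecialLinearGroup (Fin 2) R} (hg : g ∈ congruence a)
    (hh : h ∈ congruence b) : a * b ∣ (h⁻¹ * g * h) 0 0 - g 0 0 := by
  obtain ⟨⟨x, hx⟩, ⟨y, hy⟩, ⟨z, hz⟩, ⟨w, hw⟩⟩ := hg
  obtain ⟨-, ⟨y', hy'⟩, ⟨z', hz'⟩, -⟩ := hh
  have hd := det_eq h
  rw [sub_eq_iff_eq_add] at hx hw
  refine ⟨h 1 1 * y * z' - y' * z * h 0 0 - y' * h 1 0 * (w - x), ?_⟩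
  simp only [mul_apply, inv_00, inv_01]
  simp only [hx, hy, hz, hw]
  linear_combination (a * x + 1) * hd + (h 1 1 * a * y) * hz' -
    (a * z * h 0 0 + a * (w - x) * h 1 0) * hy'

variable {V : Type*} [AddCommGroup V] [Module ℂ V]
  (ρ : Representation ℂ (SpecialLinearGroup (Fin 2) R) V)

/-- The vectors on which `congruence a` acts through the upper left entry. -/
def diagEigenspace (a : R) (Φ : AddChar R ℂ) : Submodule ℂ V where
  carrier := {v | ∀ g ∈ congruence a, ρ g v = Φ (g 0 0 - 1) • v}
  zero_mem' := by simp
  add_mem' := fun {x y} hx hy g hg => by rw [map_add, hx g hg, hy g hg, smul_add]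
  smul_mem' := fun c x hx g hg => by rw [map_smul, hx g hg, smul_comm]

variable {ρ} {π : R} {l : ℕ} {Φ : AddChar R ℂ}

theorem map_mem_diagEigenspace (hΦ : IsLevel π l Φ) (hl : 1 ≤ l) {v : V}
    (hv : v ∈ diagEigenspace ρ (π ^ (l - 1)) Φ) {h : SpecialLinearGroup (Fin 2) R}
    (hh : h ∈ congruence π) : ρ h v ∈ diagEigenspace ρ (π ^ (l - 1)) Φ := by
  intro g hg
  have h1 : ρ g (ρ h v) = ρ h (ρ (h⁻¹ * g * h) v) := by
    simp only [← Module.End.mul_apply, ← map_mul]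
    congr 2
    group
  have h2 := conj_00_sub_dvd hg hh
  rw [← pow_succ, Nat.sub_add_cancel hl] at h2
  rw [h1, hv _ (conj_mem_congruence hg h), map_smul,
    show (h⁻¹ * g * h) 0 0 - 1 = ((h⁻¹ * g * h) 0 0 - g 0 0) + (g 0 0 - 1) by ring,
    AddChar.map_add_eq_mul, hΦ.eq_one _ h2, one_mul]

/-- A Heisenberg-type relation: the commutator of the two unipotents is in the congruence subgroup
and acts by `Φ (b * c)`, the quadratic term being invisible at level `l`. -/
theorem lower_upper_lower_apply (hΦ : IsLevel π l Φ) (hl : 2 ≤ l) {v : V}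
    (hv : v ∈ diagEigenspace ρ (π ^ (l - 1)) Φ) {b c : R} (hbc : π ^ (l - 1) ∣ b * c) :
    ρ (lower (-c)) (ρ (upper b) (ρ (lower c) v)) = Φ (b * c) • ρ (upper b) v := by
  let κ : SpecialLinearGroup (Fin 2) R := mk (1 + b * c + (b * c) * (b * c)) (b * c * b) (-(b * c * c))
    (1 - b * c) (by ring)
  have h1 : lower (-c) * (upper b * lower c) = upper b * κ := by
    apply ext' <;> simp only [κ, mul_apply, upper, lower, mk_00, mk_01, mk_10, mk_11] <;> ring
  have hκ : κ ∈ congruence (π ^ (l - 1)) := by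
    refine ⟨?_, ?_, ?_, ?_⟩
    · have : κ 0 0 - 1 = b * c * (1 + b * c) := by simp only [κ, mk_00]; ring
      rw [this]
      exact Dvd.dvd.mul_right hbc _
    · exact Dvd.dvd.mul_right hbc _
    · exact (dvd_neg).2 (Dvd.dvd.mul_right hbc _)
    · have : κ 1 1 - 1 = b * c * (-1) := by simp only [κ, mk_11]; ring
      rw [this]
      exact Dvd.dvd.mul_right hbc _
  have h2 : κ 0 0 - 1 = b * c + (b * c) * (b * c) := by simp only [κ, mk_00]; ring
  have h3 : π ^ l ∣ (b * c) * (b * c) := by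
    refine (pow_dvd_pow π (show l ≤ (l - 1) + (l - 1) by omega)).trans ?_
    rw [pow_add]
    exact mul_dvd_mul hbc hbc
  rw [← Module.End.mul_apply, ← Module.End.mul_apply, ← map_mul, ← map_mul, mul_assoc, h1, map_mul,
    Module.End.mul_apply, hv κ hκ, h2, AddChar.map_add_eq_mul, hΦ.eq_one _ h3, mul_one, map_smul]

/-- If all these averages vanished, undoing the lower unipotents and summing over `γ` would leave,
by orthogonality, only the `β` divisible by `π`. For these the upper unipotent fixes `v`, so a
nonzero multiple of `v` would vanish. -/
theorem exists_sum_upper_ne_zero [Fintype R] (hΦ : IsLevel π l Φ) (hl : 2 ≤ l) {i : ℕ} (hi : 1 ≤ i)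
    (hil : i ≤ l - 1) {v : V} (hv0 : v ≠ 0) (hv : v ∈ diagEigenspace ρ (π ^ (l - 1)) Φ)
    (hfix : ∀ b, π ^ i ∣ b → ρ (upper b) v = v) :
    ∃ γ, ∑ β, ρ (upper (π ^ (i - 1) * β)) (ρ (lower (π ^ (l - i) * γ)) v) ≠ 0 := by
  classical
  by_contra! h
  have h0 : ∑ γ, ρ (lower (-(π ^ (l - i) * γ)))
      (∑ β, ρ (upper (π ^ (i - 1) * β)) (ρ (lower (π ^ (l - i) * γ)) v)) = 0 :=
    Finset.sum_eq_zero fun γ _ => by rw [h γ, map_zero]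
  have hpow : ∀ β γ, π ^ (i - 1) * β * (π ^ (l - i) * γ) = π ^ (l - 1) * β * γ := fun β γ => by
    rw [show l - 1 = (i - 1) + (l - i) by omega, pow_add]
    ring
  have h1 : ∀ β, ∑ γ, ρ (lower (-(π ^ (l - i) * γ)))
      (ρ (upper (π ^ (i - 1) * β)) (ρ (lower (π ^ (l - i) * γ)) v)) =
      (if π ∣ β then (Fintype.card R : ℂ) else 0) • v := by
    intro β
    have h2 : ∀ γ, ρ (lower (-(π ^ (l - i) * γ)))
        (ρ (upper (π ^ (i - 1) * β)) (ρ (lower (π ^ (l - i) * γ)) v)) =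
        Φ.mulShift (π ^ (l - 1) * β) γ • ρ (upper (π ^ (i - 1) * β)) v := by
      intro γ
      rw [lower_upper_lower_apply hΦ hl hv (by rw [hpow, mul_assoc]; exact dvd_mul_right _ _), hpow,
        AddChar.mulShift_apply]
    rw [Finset.sum_congr rfl fun γ _ => h2 γ, ← Finset.sum_smul, AddChar.sum_eq_ite]
    by_cases hβ : π ∣ β
    · have h3 : Φ.mulShift (π ^ (l - 1) * β) = 0 := by
        ext γ
        rw [AddChar.mulShift_apply, AddChar.zero_apply]
        apply hΦ.eq_one
        obtain ⟨β', rfl⟩ := hβ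
        refine ⟨β' * γ, ?_⟩
        nth_rewrite 2 [show l = (l - 1) + 1 by omega]
        rw [pow_succ]
        ring
      rw [if_pos h3, if_pos hβ, hfix]
      obtain ⟨β', rfl⟩ := hβ
      refine ⟨β', ?_⟩
      nth_rewrite 2 [show i = (i - 1) + 1 by omega]
      rw [pow_succ]
      ring
    · have h3 : Φ.mulShift (π ^ (l - 1) * β) ≠ 0 := fun h3 => hβ (hΦ.dvd β fun γ => by
        rw [← AddChar.mulShift_apply, h3, AddChar.zero_apply])
      rw [if_neg h3, if_neg hβ, zero_smul, zero_smul]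
  simp only [map_sum] at h0
  rw [Finset.sum_comm, Finset.sum_congr rfl fun β _ => h1 β, ← Finset.sum_smul, Finset.sum_ite,
    Finset.sum_const_zero, add_zero, Finset.sum_const, nsmul_eq_mul, smul_eq_zero] at h0
  rcases h0 with h0 | h0
  · rw [mul_eq_zero, Nat.cast_eq_zero, Nat.cast_eq_zero, Finset.card_eq_zero] at h0
    rcases h0 with h0 | h0
    · have : (0 : R) ∈ Finset.univ.filter (π ∣ ·) := by simp
      rw [h0] at this
      simp at this
    · exact Fintype.card_ne_zero h0
  · exact hv0 h0

theorem upper_sum_upper [Fintype R] (a b : R) (w : V) :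
    ρ (upper (a * b)) (∑ β, ρ (upper (a * β)) w) = ∑ β, ρ (upper (a * β)) w := by
  rw [map_sum]
  refine Fintype.sum_equiv (Equiv.addLeft b) _ _ fun β => ?_
  rw [Equiv.coe_addLeft, mul_add, upper_add, map_mul, Module.End.mul_apply]

/-- Each averaging lowers the exponent by one. It stops at exponent 1 because only conjugation by
elements congruent to 1 modulo `π` preserves the eigenspace. -/
theorem exists_upper_fixed [Finite R] (hΦ : IsLevel π l Φ) (hl : 2 ≤ l) {v : V} (hv0 : v ≠ 0)
    (hv : v ∈ diagEigenspace ρ (π ^ (l - 1)) Φ) {i : ℕ} (hi : 1 ≤ i) (hil : i ≤ l - 1) :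
    ∃ w ∈ diagEigenspace ρ (π ^ (l - 1)) Φ, w ≠ 0 ∧ ∀ b, π ^ i ∣ b → ρ (upper b) w = w := by
  have := Fintype.ofFinite R
  induction hil using Nat.decreasingInduction with
  | self =>
    refine ⟨v, hv, hv0, fun b hb => ?_⟩
    rw [hv _ (upper_mem_congruence hb)]
    simp [upper]
  | of_succ j hj ih =>
    obtain ⟨w, hw, hw0, hfix⟩ := ih (by omega)
    obtain ⟨γ, hγ⟩ := exists_sum_upper_ne_zero hΦ hl (by omega) hj hw0 hw hfix
    rw [show j + 1 - 1 = j from rfl] at hγ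
    refine ⟨_, ?_, hγ, ?_⟩
    · refine Submodule.sum_mem _ fun β _ => ?_
      refine map_mem_diagEigenspace hΦ (by omega) (map_mem_diagEigenspace hΦ (by omega) hw ?_) ?_
      · exact lower_mem_congruence (Dvd.dvd.mul_right (dvd_pow_self _ (by omega)) _)
      · exact upper_mem_congruence (Dvd.dvd.mul_right (dvd_pow_self _ (by omega)) _)
    · rintro _ ⟨b, rfl⟩
      exact upper_sum_upper _ _ _

/-- The vectors fixed by the upper unipotent matrices on which the principal units act
through `Φ`. -/
def toralEigenspace (ρ : Representation ℂ (SpecialLinearGroup (Fin 2) R) V) (a : R)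
    (Φ : AddChar R ℂ) : Submodule ℂ V where
  carrier := {v | (∀ b, ρ (upper b) v = v) ∧
    ∀ x ∈ principalUnits a, ρ (torus x) v = Φ ((x : R) - 1) • v}
  zero_mem' := by simp
  add_mem' := fun {x y} hx hy => ⟨fun b => by rw [map_add, hx.1, hy.1], fun g hg => by
    rw [map_add, hx.2 g hg, hy.2 g hg, smul_add]⟩
  smul_mem' := fun c x hx => ⟨fun b => by rw [map_smul, hx.1], fun g hg => by
    rw [map_smul, hx.2 g hg, smul_comm]⟩

theorem torus_mem_congruence {a : R} {x : Rˣ} (hx : x ∈ principalUnits a) :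
    torus x ∈ congruence a := by
  refine ⟨hx, dvd_zero _, dvd_zero _, ?_⟩
  exact (principalUnits a).inv_mem hx

/-- The last averaging runs over all upper unipotents. The twist by a lower unipotent is now
trivial, being already in the congruence subgroup of level `l - 1`, and the action of the principal
units survives. -/
theorem toralEigenspace_ne_bot [Finite R] (hΦ : IsLevel π l Φ) (hl : 2 ≤ l) {v : V} (hv0 : v ≠ 0)
    (hv : v ∈ diagEigenspace ρ (π ^ (l - 1)) Φ) : toralEigenspace ρ (π ^ (l - 1)) Φ ≠ ⊥ := by
  have := Fintype.ofFinite R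
  obtain ⟨w, hw, hw0, hfix⟩ := exists_upper_fixed hΦ hl hv0 hv le_rfl (i := 1) (by omega)
  obtain ⟨γ, hγ⟩ := exists_sum_upper_ne_zero hΦ hl le_rfl (by omega) hw0 hw hfix
  have h1 : ρ (lower (π ^ (l - 1) * γ)) w = w := by
    rw [hw _ (lower_mem_congruence (dvd_mul_right _ _))]
    simp [lower]
  rw [h1] at hγ
  refine (Submodule.ne_bot_iff _).2 ⟨_, ⟨fun b => ?_, fun x hx => ?_⟩, hγ⟩
  · have := upper_sum_upper (ρ := ρ) (π ^ (1 - 1)) b w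
    rwa [show π ^ (1 - 1) * b = b by simp] at this
  · rw [map_sum, Finset.smul_sum]
    refine Finset.sum_congr rfl fun β _ => ?_
    set b := π ^ (1 - 1) * β
    have h2 : torus x * upper b = upper b * ((upper b)⁻¹ * torus x * upper b) := by group
    rw [← Module.End.mul_apply, ← map_mul, h2, map_mul, Module.End.mul_apply,
      hw _ (conj_mem_congruence (torus_mem_congruence hx) _), map_smul]
    simp [mul_apply, upper, torus]

theorem torus_mul_upper (x : Rˣ) (b : R) : torus x * upper b = upper (x * x * b) * torus x := by
  apply ext' <;> simp [mul_apply, upper, torus]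
  ring_nf
  rw [mul_assoc, mul_comm b, ← mul_assoc, pow_two, mul_assoc (x : R), Units.mul_inv, mul_one]

theorem torus_mul (x y : Rˣ) : torus (x * y) = torus x * torus y := by
  apply ext' <;> simp [mul_apply, torus, mul_comm]

/-- A Borel eigenvector whose character restricts to `Φ` on principal units. -/
theorem exists_borel_eigenvector [Finite R] [FiniteDimensional ℂ V] (hΦ : IsLevel π l Φ)
    (hl : 2 ≤ l) {v : V} (hv0 : v ≠ 0) (hv : v ∈ diagEigenspace ρ (π ^ (l - 1)) Φ) :
    ∃ χ : Rˣ →* ℂˣ, (∀ x ∈ principalUnits (π ^ (l - 1)), (χ x : ℂ) = Φ ((x : R) - 1)) ∧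
      ∃ w : V, w ≠ 0 ∧ ∀ g : borel R, ρ g w = (borelChar χ g : ℂ) • w := by
  obtain ⟨w, ⟨hw1, hw2⟩, hw0, heig⟩ := Module.End.exists_common_eigenvector
    (fun x : Rˣ => ρ (torus x)) (toralEigenspace ρ (π ^ (l - 1)) Φ)
    (toralEigenspace_ne_bot hΦ hl hv0 hv)
    (fun x w hw => ⟨fun b => by
      rw [← Module.End.mul_apply, ← map_mul,
        show upper b * torus x = torus x * upper ((x⁻¹ : Rˣ) * (x⁻¹ : Rˣ) * b) by
          rw [torus_mul_upper]
          congr 2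
          simp only [← mul_assoc, ← Units.val_mul]
          simp, map_mul, Module.End.mul_apply, hw.1], fun y hy => by
      rw [← Module.End.mul_apply, ← map_mul, ← torus_mul, mul_comm, torus_mul, map_mul,
        Module.End.mul_apply, hw.2 y hy, map_smul]⟩)
    (fun x y w _ => by
      rw [← Module.End.mul_apply, ← map_mul, ← torus_mul, mul_comm, torus_mul, map_mul,
        Module.End.mul_apply])
  choose c hc using heig
  have hc1 : c 1 = 1 := by
    have h1 : torus (1 : Rˣ) = 1 := by apply ext' <;> simp [torus]
    have := hc 1
    rw [h1, map_one, Module.End.one_apply] at this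
    nth_rewrite 1 [← one_smul ℂ w] at this
    exact (smul_left_injective ℂ hw0 this).symm
  have hcmul : ∀ x y, c (x * y) = c x * c y := by
    intro x y
    have := hc (x * y)
    rw [torus_mul, map_mul, Module.End.mul_apply, hc y, map_smul, hc x, smul_smul, mul_comm] at this
    exact (smul_left_injective ℂ hw0 this).symm
  let f : Rˣ →* ℂ := { toFun := c, map_one' := hc1, map_mul' := hcmul }
  refine ⟨f.toHomUnits, fun x hx => ?_, w, hw0, fun g => ?_⟩
  · have := hc x
    rw [hw2 x hx] at this
    exact (smul_left_injective ℂ hw0 this).symm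
  · have h1 := mem_borel.1 g.2
    have h2 := det_eq (g : SpecialLinearGroup (Fin 2) R)
    rw [h1, mul_zero, sub_zero] at h2
    have h3 : ((borelDiag g)⁻¹ : Rˣ) = (g : SpecialLinearGroup (Fin 2) R) 1 1 :=
      Units.inv_eq_of_mul_eq_one_right h2
    have h4 : (g : SpecialLinearGroup (Fin 2) R) = upper ((g : SpecialLinearGroup (Fin 2) R) 0 1 *
        (g : SpecialLinearGroup (Fin 2) R) 0 0) * torus (borelDiag g) := by
      apply ext' <;> simp only [mul_apply, upper, torus, mk_00, mk_01, mk_10, mk_11, coe_borelDiag,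
        h3]
      · ring
      · linear_combination (-(g : SpecialLinearGroup (Fin 2) R) 0 1) * h2
      · rw [h1]; ring
      · ring
    nth_rewrite 1 [h4]
    rw [map_mul, Module.End.mul_apply, hc, map_smul, hw1]
    rfl

end SL2

/-! ### Diagonalising the character modulo the maximal ideal -/

/-- The quadratic form gives the off-diagonal entries of the conjugated matrix up to sign; the rows
`(a, b)` and `(c, d)` are its two isotropic lines, scaled to determinant one. -/
theorem exists_isotropic_basis {F : Type*} [Field F] {p s t x y : F} (hne : x ≠ y)
    (hadd : x + y = p) (hmul : x * y = -(s * t)) :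
    ∃ a b c d : F, a * d - b * c = 1 ∧ t * a * a - p * a * b - s * b * b = 0 ∧
      t * c * c - p * c * d - s * d * d = 0 := by
  subst hadd
  by_cases ht : t = 0
  · subst ht
    rw [mul_zero, neg_zero] at hmul
    have hp : x + y ≠ 0 := by
      intro h
      rcases mul_eq_zero.1 hmul with rfl | rfl <;> simp_all
    refine ⟨1, 0, -s / (x + y), 1, by ring, by ring, ?_⟩
    field_simp
    ring
  · have hd : t * (x - y) ≠ 0 := mul_ne_zero ht (sub_ne_zero.2 hne)
    refine ⟨x / (t * (x - y)), t / (t * (x - y)), y, t, ?_, ?_, ?_⟩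
    · field_simp
    · have : x - y ≠ 0 := sub_ne_zero.2 hne
      field_simp
      linear_combination -hmul
    · linear_combination (-t) * hmul

theorem exists_two_roots_or {F : Type*} [Field F] (p q : F) :
    (∃ x y, x ≠ y ∧ x + y = p ∧ x * y = -q) ∨ ∃ x₀, ∀ x, x * x - p * x - q = 0 → x = x₀ := by
  by_cases h : ∃ x₀, x₀ * x₀ - p * x₀ - q = 0
  · obtain ⟨x₀, h₀⟩ := h
    by_cases h' : ∃ x, x * x - p * x - q = 0 ∧ x ≠ x₀
    · obtain ⟨x, hx, hne⟩ := h'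
      have hp : x + x₀ = p := by
        have : (x - x₀) * (x + x₀ - p) = 0 := by linear_combination hx - h₀
        exact sub_eq_zero.1 ((mul_eq_zero.1 this).resolve_left (sub_ne_zero.2 hne))
      refine Or.inl ⟨x, x₀, hne, hp, ?_⟩
      linear_combination x * hp - hx
    · push Not at h'
      exact Or.inr ⟨x₀, h'⟩
  · push Not at h
    exact Or.inr ⟨0, fun x hx => absurd hx (h x)⟩

namespace IsChainRing

variable {R k : Type*} [CommRing R] [Field k] {res : R →+* k} {π : R} {m : ℕ}

theorem exists_pow_factor (hR : IsChainRing res π m) (p s t : R) (j : ℕ) :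
    (π ^ j ∣ p ∧ π ^ j ∣ s ∧ π ^ j ∣ t) ∨ ∃ i < j, ∃ p' s' t', p = π ^ i * p' ∧ s = π ^ i * s' ∧
      t = π ^ i * t' ∧ (IsUnit p' ∨ IsUnit s' ∨ IsUnit t') := by
  induction j with
  | zero => simp
  | succ j ih =>
    rcases ih with ⟨⟨p', hp⟩, ⟨s', hs⟩, ⟨t', ht⟩⟩ | ⟨i, hi, h⟩
    · by_cases h : IsUnit p' ∨ IsUnit s' ∨ IsUnit t'
      · exact Or.inr ⟨j, by omega, p', s', t', hp, hs, ht, h⟩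
      · push Not at h
        left
        rw [hp, hs, ht, pow_succ]
        exact ⟨mul_dvd_mul_left _ ((hR.isUnit_or_dvd p').resolve_left h.1),
          mul_dvd_mul_left _ ((hR.isUnit_or_dvd s').resolve_left h.2.1),
          mul_dvd_mul_left _ ((hR.isUnit_or_dvd t').resolve_left h.2.2)⟩
    · exact Or.inr ⟨i, by omega, h⟩

theorem exists_specialLinearGroup_lift (hR : IsChainRing res π m) {a b c d : k}
    (h : a * d - b * c = 1) : ∃ g : Matrix.SpecialLinearGroup (Fin 2) R,
      res (g 0 0) = a ∧ res (g 0 1) = b ∧ res (g 1 0) = c ∧ res (g 1 1) = d := by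
  obtain ⟨a, rfl⟩ := hR.surjective a
  obtain ⟨b, rfl⟩ := hR.surjective b
  obtain ⟨c, rfl⟩ := hR.surjective c
  obtain ⟨d, rfl⟩ := hR.surjective d
  have hD : res (a * d - b * c) = 1 := by simpa using h
  obtain ⟨D, hDu⟩ := hR.isUnit _ (by rw [hD]; exact one_ne_zero)
  have hDi : res (D⁻¹ : Rˣ) = 1 := by
    have := congrArg res D.inv_mul
    rw [map_mul, hDu, hD, mul_one, map_one] at this
    exact this
  have hDm := D.inv_mul
  refine ⟨SL2.mk ((D⁻¹ : Rˣ) * a) ((D⁻¹ : Rˣ) * b) c d ?_, ?_, ?_, ?_, ?_⟩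
  · rw [← hDm, hDu]
    ring
  · simp [hDi]
  · simp [hDi]
  · simp
  · simp

end IsChainRing

/-! ### Small dimension or a primitive Borel eigenvector -/

namespace SL2

open Matrix

variable {R : Type*} [CommRing R]

/-- Conjugating by `h` makes the off-diagonal coefficients divisible by `π`, so modulo `a * π` only
the upper left entry counts. -/
theorem dvd_conj_form_sub {π a p s t : R} {g h : SpecialLinearGroup (Fin 2) R}
    (ha : π ∣ a) (hg : g ∈ congruence a)
    (h₁ : π ∣ t * h 0 0 * h 0 0 - p * h 0 0 * h 0 1 - s * h 0 1 * h 0 1)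
    (h₂ : π ∣ t * h 1 0 * h 1 0 - p * h 1 0 * h 1 1 - s * h 1 1 * h 1 1) :
    a * π ∣ (p * ((h⁻¹ * g * h) 0 0 - 1) + s * (h⁻¹ * g * h) 0 1 + t * (h⁻¹ * g * h) 1 0) -
      (p * (h 0 0 * h 1 1 + h 0 1 * h 1 0) + 2 * (s * h 0 1 * h 1 1) - 2 * (t * h 0 0 * h 1 0)) *
        (g 0 0 - 1) := by
  obtain ⟨a', rfl⟩ := ha
  obtain ⟨⟨x, hx⟩, ⟨y, hy⟩, ⟨z, hz⟩, ⟨w, hw⟩⟩ := hg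
  obtain ⟨q₁, hq₁⟩ := h₁
  obtain ⟨q₂, hq₂⟩ := h₂
  have hd := det_eq h
  have hdg := det_eq g
  rw [sub_eq_iff_eq_add] at hx hw
  rw [hx, hy, hz, hw] at hdg
  refine ⟨-(q₂ * y) + q₁ * z + (p * h 0 1 * h 1 0 + s * h 0 1 * h 1 1 - t * h 0 0 * h 1 0) *
    a' * (x * w - y * z), ?_⟩
  simp only [mul_apply, inv_00, inv_01, inv_10, inv_11]
  simp only [hx, hy, hz, hw]
  linear_combination p * hd + π * a' * z * hq₁ - π * a' * y * hq₂ -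
    (p * h 0 1 * h 1 0 + s * h 0 1 * h 1 1 - t * h 0 0 * h 1 0) * hdg

/-- Conjugation preserves the discriminant; hence the diagonal coefficient is a unit when the two
residual eigenvalues are distinct. -/
theorem conj_form_sq {p s t : R} (h : SpecialLinearGroup (Fin 2) R) :
    (p * (h 0 0 * h 1 1 + h 0 1 * h 1 0) + 2 * (s * h 0 1 * h 1 1) - 2 * (t * h 0 0 * h 1 0)) ^ 2 =
      p ^ 2 + 4 * s * t + 4 * (t * h 0 0 * h 0 0 - p * h 0 0 * h 0 1 - s * h 0 1 * h 0 1) *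
        (t * h 1 0 * h 1 0 - p * h 1 0 * h 1 1 - s * h 1 1 * h 1 1) := by
  have hd := det_eq h
  linear_combination (p ^ 2 + 4 * s * t) * (h 0 0 * h 1 1 - h 0 1 * h 1 0 + 1) * hd

theorem isLevel_mulShift {k : Type*} [Field k] {res : R →+* k} {π : R} {m : ℕ}
    (hR : IsChainRing res π m) {ψ : AddChar R ℂ} (hψ : ψ.IsPrimitive) {δ : R} (hδ : IsUnit δ)
    {i : ℕ} (hi : i < m) : IsLevel π (m - i) (ψ.mulShift (π ^ i * δ)) where
  eq_one := by
    rintro _ ⟨z, rfl⟩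
    rw [AddChar.mulShift_apply, show π ^ i * δ * (π ^ (m - i) * z) = π ^ i * π ^ (m - i) * δ * z by
      ring, ← pow_add, show i + (m - i) = m by omega, hR.pow_eq_zero, zero_mul, zero_mul,
      AddChar.map_zero_eq_one]
  dvd := by
    intro β hβ
    have h1 : π ^ (m - 1) * (β * δ) = 0 := by
      refine hψ.eq_zero fun γ => ?_
      rw [← hβ γ, AddChar.mulShift_apply, show m - 1 = i + (m - i - 1) by omega, pow_add]
      congr 1
      ring
    rw [hR.pow_mul_eq_zero_iff (by omega), show m - (m - 1) = 1 by omega, pow_one,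
      hδ.dvd_mul_right] at h1
    exact h1

theorem apply_eq_self_of_mem_congruence {V : Type*} [AddCommGroup V] [Module ℂ V]
    {ρ : Representation ℂ (SpecialLinearGroup (Fin 2) R) V} {v : V}
    (hgen : Submodule.span ℂ (Set.range fun g => ρ g v) = ⊤) {a : R}
    (hv : ∀ g ∈ congruence a, ρ g v = v) {g : SpecialLinearGroup (Fin 2) R}
    (hg : g ∈ congruence a) (w : V) : ρ g w = w := by
  have hw : w ∈ Submodule.span ℂ (Set.range fun g => ρ g v) := by rw [hgen]; trivial
  induction hw using Submodule.span_induction with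
  | mem x hx =>
    obtain ⟨h, rfl⟩ := hx
    have h1 : ρ g (ρ h v) = ρ h (ρ (h⁻¹ * g * h) v) := by
      simp only [← Module.End.mul_apply, ← map_mul]
      congr 2
      group
    rw [h1, hv _ (conj_mem_congruence hg h)]
  | zero => simp
  | add x y _ _ hx hy => rw [map_add, hx, hy]
  | smul c x _ hx => rw [map_smul, hx]

/-- An imprimitive Borel eigenvector forces the dimension to be small. -/
theorem finrank_mul_card_borel_lt_of_borel_eigenvector [Finite R] {c : R} (hc0 : c ≠ 0)
    (hc : ∀ x y : R, IsUnit (x + c * y) → IsUnit x)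
    {V : Type*} [AddCommGroup V] [Module ℂ V] [FiniteDimensional ℂ V] [Nontrivial V]
    {ρ : Representation ℂ (SpecialLinearGroup (Fin 2) R) V} {χ : Rˣ →* ℂˣ} {w : V}
    (hgen : Submodule.span ℂ (Set.range fun g => ρ g w) = ⊤)
    (htriv : ∀ g ∈ congruence c, ρ g w = w)
    (hw : ∀ g : borel R, ρ g w = (borelChar χ g : ℂ) • w) :
    Module.finrank ℂ V * Nat.card (borel R) < Nat.card (SpecialLinearGroup (Fin 2) R) := by
  have hlt : Nat.card (borel R) < Nat.card (lowerDvd c) := by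
    suffices (borel R : Set (SpecialLinearGroup (Fin 2) R)) ⊂ lowerDvd c from
      Set.ncard_lt_ncard this (Set.toFinite _)
    refine ⟨fun g hg => ?_, fun h => hc0 ?_⟩
    · rw [SetLike.mem_coe, mem_borel] at hg
      rw [SetLike.mem_coe, mem_lowerDvd, hg]
      exact dvd_zero _
    · have : lower c ∈ borel R := h (by simp [mem_lowerDvd, lower])
      rw [mem_borel] at this
      simpa [lower] using this
  refine lt_of_lt_of_le (Nat.mul_lt_mul_of_pos_left hlt Module.finrank_pos)
    (ρ.finrank_mul_card_le (lowerDvd c) w (fun g hg => ?_) hgen)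
  obtain ⟨y, hy⟩ := mem_lowerDvd.1 hg
  obtain ⟨u, hu⟩ : IsUnit (g 0 0) := by
    refine isUnit_of_mul_isUnit_left (y := g 1 1) (hc _ (-(g 0 1 * y)) ?_)
    rw [show g 0 0 * g 1 1 + c * -(g 0 1 * y) = g 0 0 * g 1 1 - g 0 1 * (c * y) by ring, ← hy,
      det_eq]
    exact isUnit_one
  have hui := u.inv_mul
  rw [hu] at hui
  -- Factor `g` as `κ`, which fixes `w`, times an element of the Borel subgroup; so the whole of
  -- `lowerDvd c` preserves the line of `w`.
  let κ : SpecialLinearGroup (Fin 2) R := lower (c * (y * (u⁻¹ : Rˣ)))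
  have hb : κ⁻¹ * g ∈ borel R := by
    rw [mem_borel, mul_apply]
    simp only [inv_10, inv_11, κ, lower, mk_00, mk_10, hy]
    linear_combination (-c * y) * hui
  refine ⟨borelChar χ ⟨_, hb⟩, ?_⟩
  rw [← hw ⟨_, hb⟩]
  have h2 := htriv κ (lower_mem_congruence (dvd_mul_right _ _))
  have h3 := hw ⟨_, hb⟩
  nth_rewrite 1 [show g = κ * (κ⁻¹ * g) by group]
  rw [map_mul, Module.End.mul_apply]
  simp only at h3
  rw [h3, map_smul, h2]

theorem finrank_mul_card_borel_lt_or [Finite R] {k : Type*} [Field k] {res : R →+* k} {π : R}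
    {r : ℕ} (hR : IsChainRing res π (2 * r)) {p s t : R} (hpst : IsUnit p ∨ IsUnit s ∨ IsUnit t)
    {i : ℕ} (hi : i < r) {ψ : AddChar R ℂ} (hψ : ψ.IsPrimitive)
    {V : Type*} [AddCommGroup V] [Module ℂ V] [FiniteDimensional ℂ V]
    (ρ : Representation ℂ (SpecialLinearGroup (Fin 2) R) V)
    (hgen : ∀ v ≠ 0, Submodule.span ℂ (Set.range fun g => ρ g v) = ⊤) {v : V} (hv : v ≠ 0)
    (heig : ∀ g ∈ congruence (π ^ r),
      ρ g v = ψ (π ^ i * (p * (g 0 0 - 1) + s * g 0 1 + t * g 1 0)) • v) :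
    Module.finrank ℂ V * Nat.card (borel R) < Nat.card (SpecialLinearGroup (Fin 2) R) ∨
      ∃ χ : Rˣ →* ℂˣ, IsPrimitiveChar π (2 * r) χ ∧
        ∃ w : V, w ≠ 0 ∧ ∀ g : borel R, ρ g w = (borelChar χ g : ℂ) • w := by
  have : Nontrivial V := ⟨⟨_, _, hv⟩⟩
  rcases exists_two_roots_or (res p) (res s * res t) with ⟨x, y, hne, hadd, hmul⟩ | ⟨x₀, hx₀⟩
  swap
  · obtain ⟨l, rfl⟩ := hR.surjective x₀
    refine Or.inl (finrank_mul_card_borel_lt hR (l := l) (fun x y hxy => ?_) hpst (π ^ i) ρ hgen hv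
      heig)
    simp only [map_add, map_sub, map_mul] at hxy ⊢
    by_cases hy : res y = 0
    · rw [hy] at hxy ⊢
      simpa using hxy
    · have := hx₀ (-(res x / res y)) (by field_simp; linear_combination hxy)
      rw [← this]
      field_simp
      ring
  obtain ⟨a, b, c, d, habcd, hab, hcd⟩ := exists_isotropic_basis hne hadd hmul
  obtain ⟨h, rfl, rfl, rfl, rfl⟩ := hR.exists_specialLinearGroup_lift habcd
  have h₁ : π ∣ t * h 0 0 * h 0 0 - p * h 0 0 * h 0 1 - s * h 0 1 * h 0 1 := by
    rw [← hR.map_eq_zero_iff]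
    simpa using hab
  have h₂ : π ∣ t * h 1 0 * h 1 0 - p * h 1 0 * h 1 1 - s * h 1 1 * h 1 1 := by
    rw [← hR.map_eq_zero_iff]
    simpa using hcd
  have hsq := conj_form_sq (p := p) (s := s) (t := t) h
  set δ := p * (h 0 0 * h 1 1 + h 0 1 * h 1 0) + 2 * (s * h 0 1 * h 1 1) -
    2 * (t * h 0 0 * h 1 0) with hδ
  have hδu : IsUnit δ := by
    rw [hR.isUnit_iff]
    intro h0
    have := congrArg res hsq
    rw [map_pow, h0, map_add, map_mul, (hR.map_eq_zero_iff _).2 h₂] at this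
    simp only [map_add, map_mul, map_pow, map_ofNat] at this
    have h3 : (x - y) ^ 2 = 0 := by
      rw [← hadd] at this
      linear_combination -this - 4 * hmul
    exact hne (sub_eq_zero.1 (pow_eq_zero_iff two_ne_zero |>.1 h3))
  -- The diagonal character has level `l`, and `i < r` gives `r ≤ l - 1`.
  set l := 2 * r - i with hl
  have hΦ := isLevel_mulShift hR hψ hδu (i := i) (by omega)
  have hle : congruence (π ^ (l - 1)) ≤ congruence (π ^ r) :=
    congruence_le (pow_dvd_pow _ (by omega))
  have hπ : π ^ i * π ^ l = 0 := by rw [← pow_add, show i + l = 2 * r by omega, hR.pow_eq_zero]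
  have hv' : ρ h v ∈ diagEigenspace ρ (π ^ (l - 1)) (ψ.mulShift (π ^ i * δ)) := by
    intro g hg
    have h1 : ρ g (ρ h v) = ρ h (ρ (h⁻¹ * g * h) v) := by
      simp only [← Module.End.mul_apply, ← map_mul]
      congr 2
      group
    rw [h1, heig _ (hle (conj_mem_congruence hg h)), map_smul, AddChar.mulShift_apply]
    congr 2
    obtain ⟨z, hz⟩ := dvd_conj_form_sub (dvd_pow_self π (by omega : l - 1 ≠ 0)) hg h₁ h₂
    rw [← pow_succ, Nat.sub_add_cancel (by omega)] at hz
    linear_combination π ^ i * hz + z * hπ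
  have hv0 : ρ h v ≠ 0 := by
    intro h0
    have := congrArg (ρ h⁻¹) h0
    rw [← Module.End.mul_apply, ← map_mul] at this
    exact hv (by simpa using this)
  obtain ⟨χ, hχ, w, hw0, hw⟩ := exists_borel_eigenvector hΦ (by omega) hv0 hv'
  -- For `i = 0` the level is the full length, so `χ` is primitive. For `i > 0` the representation
  -- is trivial on the congruence subgroup of level `l < 2 * r`, and the stabilizer of the line
  -- exceeds the Borel subgroup.
  rcases Nat.eq_zero_or_pos i with rfl | hi0
  · refine Or.inr ⟨χ, ?_, w, hw0, hw⟩
    by_contra hcon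
    refine hR.not_isUnit (hΦ.dvd 1 fun γ => ?_) isUnit_one
    rw [mul_one]
    obtain ⟨u, hu⟩ : IsUnit (1 + π ^ (l - 1) * γ) := by
      rw [hR.isUnit_iff, map_add, map_mul, map_pow, (hR.map_eq_zero_iff π).2 dvd_rfl,
        zero_pow (by omega), map_one]
      simp
    have hmem : u ∈ principalUnits (π ^ (l - 1)) := by
      rw [mem_principalUnits, hu]
      exact ⟨γ, by ring⟩
    have h3 := hχ u hmem
    rw [hu, add_sub_cancel_left] at h3
    rw [← h3]
    have : χ u = 1 := by
      by_contra hne'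
      exact hcon ⟨u, hmem, hne'⟩
    rw [this, Units.val_one]
  · left
    refine finrank_mul_card_borel_lt_of_borel_eigenvector (c := π ^ l) ?_ (fun x y hxy => ?_)
      (hgen w hw0) (fun g hg => ?_) hw
    · rw [Ne, hR.pow_eq_zero_iff]
      omega
    · rw [hR.isUnit_iff] at hxy ⊢
      rwa [map_add, map_mul, map_pow, (hR.map_eq_zero_iff π).2 dvd_rfl, zero_pow (by omega),
        zero_mul, add_zero] at hxy
    · refine apply_eq_self_of_mem_congruence (hgen v hv) (a := π ^ l) (fun g hg => ?_) hg w
      rw [heig g (congruence_le (pow_dvd_pow _ (by omega)) hg)]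
      obtain ⟨⟨x, hx⟩, ⟨y, hy⟩, ⟨z, hz⟩, -⟩ := hg
      rw [hx, hy, hz, show π ^ i * (p * (π ^ l * x) + s * (π ^ l * y) + t * (π ^ l * z)) =
        π ^ i * π ^ l * (p * x + s * y + t * z) by ring, hπ, zero_mul, AddChar.map_zero_eq_one,
        one_smul]

/-- A representation generated by each of its nonzero vectors has dimension less than the index
of the Borel subgroup, or contains a primitive Borel eigenvector. -/
theorem exists_primitive_borel_eigenvector [Finite R] {k : Type*} [Field k] {res : R →+* k} {π : R}
    {r : ℕ} (hR : IsChainRing res π (2 * r))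
    {V : Type*} [AddCommGroup V] [Module ℂ V] [FiniteDimensional ℂ V] [Nontrivial V]
    (ρ : Representation ℂ (SpecialLinearGroup (Fin 2) R) V)
    (hgen : ∀ v ≠ 0, Submodule.span ℂ (Set.range fun g => ρ g v) = ⊤) :
    Module.finrank ℂ V * Nat.card (borel R) < Nat.card (SpecialLinearGroup (Fin 2) R) ∨
      ∃ χ : Rˣ →* ℂˣ, IsPrimitiveChar π (2 * r) χ ∧
        ∃ w : V, w ≠ 0 ∧ ∀ g : borel R, ρ g w = (borelChar χ g : ℂ) • w := by
  have hr := hR.pos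
  have ha : ∀ z : R, π ^ r * z = 0 ↔ π ^ r ∣ z := fun z => by
    rw [hR.pow_mul_eq_zero_iff (by omega), show 2 * r - r = r by omega]
  obtain ⟨ψ, hψ⟩ := hR.exists_isPrimitive
  obtain ⟨v, -, hv, heig⟩ := Module.End.exists_common_eigenvector
    (fun h : congruence (π ^ r) => ρ h) ⊤ top_ne_bot (fun _ _ _ => trivial) (fun g h w _ => by
      simp only [← Module.End.mul_apply, ← map_mul]
      rw [mul_comm_of_mem_congruence ((ha _).2 dvd_rfl) g.2 h.2])
  obtain ⟨p, s, t, hpst⟩ := exists_linear_form ha hψ ρ hv fun g hg => heig ⟨g, hg⟩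
  rcases hR.exists_pow_factor p s t r with ⟨hp, hs, ht⟩ | ⟨i, hi, p, s, t, rfl, rfl, rfl, hu⟩
  -- The congruence subgroup acts trivially on `v`. The trivial character is written as 0 times the
  -- form of a nilpotent matrix, to reuse the bound without distinct eigenvalues.
  · refine Or.inl (finrank_mul_card_borel_lt hR (p := 0) (s := 1) (t := 0) (l := 0) (ψ := ψ) ?_
      (by simp) 0 ρ hgen hv fun g hg => ?_)
    · intro x y
      simp
    · have h0 : ∀ x y, π ^ r ∣ x → π ^ r ∣ y → x * y = 0 := by
        rintro _ _ ⟨x, rfl⟩ hy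
        rw [mul_right_comm, (ha _).2 hy, zero_mul]
      rw [hpst g hg, h0 _ _ hp hg.1, h0 _ _ hs hg.2.1, h0 _ _ ht hg.2.2.1]
      simp
  · refine finrank_mul_card_borel_lt_or hR hu hi hψ ρ hgen hv fun g hg => ?_
    rw [hpst g hg]
    congr 2
    ring

end SL2

/-! ### Left ideals as representations -/

namespace MonoidAlgebra

variable {G : Type*} [Group G]

/-- The left ideal generated by `f` as a representation. -/
noncomputable def leftIdealRep (f : MonoidAlgebra ℂ G) :
    Representation ℂ G (LinearMap.range (LinearMap.mulRight ℂ f)) where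
  toFun g := (LinearMap.mulLeft ℂ (single g (1 : ℂ))).restrict <| by
    rintro _ ⟨a, rfl⟩
    exact ⟨single g 1 * a, by simp [mul_assoc]⟩
  map_one' := by
    ext x
    simp [← one_def]
  map_mul' g h := by
    ext x
    simp [← mul_assoc, single_mul_single]

@[simp] theorem coe_leftIdealRep_apply (f : MonoidAlgebra ℂ G) (g : G)
    (x : LinearMap.range (LinearMap.mulRight ℂ f)) :
    (leftIdealRep f g x : MonoidAlgebra ℂ G) = single g 1 * (x : MonoidAlgebra ℂ G) := rfl

theorem span_range_leftIdealRep_eq_top [Finite G] {f b : MonoidAlgebra ℂ G}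
    (x : LinearMap.range (LinearMap.mulRight ℂ f)) (hb : b * (x : MonoidAlgebra ℂ G) = f) :
    Submodule.span ℂ (Set.range fun g => leftIdealRep f g x) = ⊤ := by
  have := Fintype.ofFinite G
  rw [eq_top_iff]
  rintro ⟨_, a, rfl⟩ -
  have h1 : (⟨LinearMap.mulRight ℂ f a, a, rfl⟩ : LinearMap.range (LinearMap.mulRight ℂ f)) =
      ∑ g, (a * b).coeff g • leftIdealRep f g x := by
    ext1
    rw [Submodule.coe_sum]
    simp only [Submodule.coe_smul, coe_leftIdealRep_apply, ← smul_mul_assoc]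
    rw [← Finset.sum_mul, ← eq_sum_coeff_smul_single, mul_assoc, hb]
    rfl
  rw [h1]
  exact Submodule.sum_mem _ fun g _ => Submodule.smul_mem _ _ (Submodule.subset_span ⟨g, rfl⟩)

theorem finrank_eq_card {G : Type*} [Finite G] : Module.finrank ℂ (MonoidAlgebra ℂ G) = Nat.card G := by
  have := Fintype.ofFinite G
  rw [(coeffLinearEquiv ℂ).finrank_eq, Module.finrank_finsupp_self, Nat.card_eq_fintype_card]

end MonoidAlgebra

theorem charIdem.finrank_range_mul_card_le {G : Type*} [Group G] [Finite G] (H : Subgroup G)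
    (lam : H →* ℂˣ) :
    Module.finrank ℂ (LinearMap.range (LinearMap.mulRight ℂ (charIdem H lam))) * Nat.card H ≤
      Nat.card G := by
  refine (MonoidAlgebra.leftIdealRep (charIdem H lam)).finrank_mul_card_le H
    ⟨charIdem H lam, 1, one_mul _⟩ (fun h hh => ⟨lam ⟨h, hh⟩, ?_⟩)
    (MonoidAlgebra.span_range_leftIdealRep_eq_top (b := 1) _ (one_mul _))
  ext1
  exact charIdem.single_mul ⟨h, hh⟩

theorem AlgEquiv.finrank_range_mulRight {A A' : Type*} [Ring A] [Algebra ℂ A] [Ring A']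
    [Algebra ℂ A'] (φ : A ≃ₐ[ℂ] A') (e : A) :
    Module.finrank ℂ (LinearMap.range (LinearMap.mulRight ℂ (φ e))) =
      Module.finrank ℂ (LinearMap.range (LinearMap.mulRight ℂ e)) := by
  rw [← LinearEquiv.finrank_map_eq φ.toLinearEquiv]
  suffices LinearMap.range (LinearMap.mulRight ℂ (φ e)) =
      (LinearMap.range (LinearMap.mulRight ℂ e)).map (φ.toLinearEquiv : A →ₗ[ℂ] A') by rw [this]
  ext x
  constructor
  · rintro ⟨a, rfl⟩
    exact ⟨φ.symm a * e, ⟨φ.symm a, rfl⟩, by simp⟩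
  · rintro ⟨_, ⟨a, rfl⟩, rfl⟩
    exact ⟨φ a, by simp⟩

/-- Two minimal idempotents linked to a third one are linked. -/
theorem IsMinimalIdempotent.exists_mul_mul_ne_zero {A : Type*} [Ring A] [Algebra ℂ A]
    [IsSemisimpleRing A] {e : A} (he : IsMinimalIdempotent e) {a₁ a₂ f₁ f₂ : A}
    (h₁ : e * a₁ * f₁ ≠ 0) (h₂ : e * a₂ * f₂ ≠ 0) : ∃ b, f₁ * b * f₂ ≠ 0 := by
  obtain ⟨b, hb⟩ := IsSemisimpleRing.exists_mul_mul_ne_zero h₁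
  obtain ⟨c, hc⟩ := he.corner (a₁ * f₁ * b)
  have hc0 : c ≠ 0 := by
    rintro rfl
    apply hb
    rw [show e * a₁ * f₁ * b * (e * a₁ * f₁) = e * (a₁ * f₁ * b) * e * (a₁ * f₁) by
      simp only [mul_assoc], hc, zero_smul, zero_mul]
  refine ⟨b * e * a₂, fun h => h₂ ?_⟩
  have : c • (e * a₂ * f₂) = 0 := by
    rw [mul_assoc e, ← smul_mul_assoc, ← hc]
    calc e * (a₁ * f₁ * b) * e * (a₂ * f₂) = e * a₁ * (f₁ * (b * e * a₂) * f₂) := by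
          simp only [mul_assoc]
      _ = 0 := by rw [h, mul_zero]
  exact (smul_eq_zero.1 this).resolve_left hc0

/-! ### Comparing the two group algebras -/

namespace SL2

open Matrix

variable {R : Type*} [CommRing R] [Finite R] {k : Type*} [Field k] {res : R →+* k} {π : R} {r : ℕ}

/-- The dimension hypothesis leaves only the primitive eigenvector, and then makes `f` equivalent to
`principalIdem χ`. The latter is thus minimal, which excludes `χ = χ⁻¹`; the Weyl element links `f`
to `χ⁻¹` as well. -/
theorem exists_primitive_of_isMinimalIdempotent (hR : IsChainRing res π (2 * r))
    {f : MonoidAlgebra ℂ (SpecialLinearGroup (Fin 2) R)} (hf : IsMinimalIdempotent f)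
    (hdim : Nat.card (SpecialLinearGroup (Fin 2) R) ≤
      Module.finrank ℂ (LinearMap.range (LinearMap.mulRight ℂ f)) * Nat.card (borel R)) :
    ∃ χ : Rˣ →* ℂˣ, IsPrimitiveChar π (2 * r) χ ∧ χ ≠ χ⁻¹ ∧
      (∃ a, principalIdem χ * a * f ≠ 0) ∧ ∃ a, principalIdem χ⁻¹ * a * f ≠ 0 := by
  have hfix : ∀ x : LinearMap.range (LinearMap.mulRight ℂ f),
      (x : MonoidAlgebra ℂ (SpecialLinearGroup (Fin 2) R)) * f = x := by
    rintro ⟨_, a, rfl⟩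
    simp [mul_assoc, hf.idem]
  have : Nontrivial (LinearMap.range (LinearMap.mulRight ℂ f)) :=
    ⟨⟨f, 1, one_mul _⟩, 0, fun h => hf.ne_zero (congrArg Subtype.val h)⟩
  have hgen : ∀ x ≠ 0, Submodule.span ℂ (Set.range fun g => MonoidAlgebra.leftIdealRep f g x) =
      ⊤ := by
    intro x hx
    obtain ⟨b, hb⟩ := hf.exists_mul_eq (hfix x) (by simpa using hx)
    exact MonoidAlgebra.span_range_leftIdealRep_eq_top x hb
  rcases exists_primitive_borel_eigenvector hR _ hgen with h | ⟨χ, hχ, w, hw0, hw⟩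
  · exact absurd hdim (not_le.2 h)
  have hw0' : (w : MonoidAlgebra ℂ (SpecialLinearGroup (Fin 2) R)) ≠ 0 := by simpa using hw0
  have hew : principalIdem χ * (w : MonoidAlgebra ℂ (SpecialLinearGroup (Fin 2) R)) = w :=
    charIdem.mul_eq_self fun g => congrArg Subtype.val (hw g)
  have hle := (charIdem.finrank_range_mul_card_le (borel R) (borelChar χ)).trans hdim
  obtain ⟨y, hyw, hwy⟩ := hf.exists_inverse_of_finrank_le charIdem.mul_self hew (hfix w) hw0'
    (Nat.le_of_mul_le_mul_right hle Nat.card_pos)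
  have : Nontrivial R := hR.nontrivial
  refine ⟨χ, hχ, fun h => principalIdem_not_isMinimal h
    (hf.of_inverse charIdem.mul_self (hfix w) hyw hwy), ⟨w, by rwa [hew, hfix]⟩,
    MonoidAlgebra.single weyl 1 * (w : MonoidAlgebra ℂ (SpecialLinearGroup (Fin 2) R)),
    fun h => coeff_principalIdem_inv_mul_weyl_mul χ ?_⟩
  have h1 : principalIdem χ⁻¹ * MonoidAlgebra.single weyl 1 * principalIdem χ = 0 := by
    rw [mul_assoc, mul_assoc, hfix] at h
    change principalIdem χ⁻¹ * MonoidAlgebra.single weyl 1 * charIdem (borel R) (borelChar χ) = 0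
    rw [← hwy, ← mul_assoc, mul_assoc (principalIdem χ⁻¹), h, zero_mul]
  rw [h1]
  rfl

variable {R' : Type*} [CommRing R'] [Finite R'] {k' : Type*} [Field k'] {res' : R' →+* k'} {π' : R'}

/-- Double counting of linked pairs: each `χ` is linked to at least the two distinct characters `χ'`
and `χ'⁻¹`, while any two characters linked to the same `χ'` are equal or inverse. -/
theorem card_primitiveChar_le (hR : IsChainRing res π (2 * r)) (hR' : IsChainRing res' π' (2 * r))
    (φ : MonoidAlgebra ℂ (SpecialLinearGroup (Fin 2) R) ≃ₐ[ℂ]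
      MonoidAlgebra ℂ (SpecialLinearGroup (Fin 2) R'))
    (hB : Nat.card (borel R) = Nat.card (borel R'))
    (hne : ∀ χ : Rˣ →* ℂˣ, IsPrimitiveChar π (2 * r) χ → χ ≠ χ⁻¹) :
    {χ : Rˣ →* ℂˣ | IsPrimitiveChar π (2 * r) χ}.ncard ≤
      {χ : R'ˣ →* ℂˣ | IsPrimitiveChar π' (2 * r) χ ∧ χ ≠ χ⁻¹}.ncard := by
  classical
  have : Finite (Rˣ →* ℂˣ) := inferInstance
  have : Finite (R'ˣ →* ℂˣ) := inferInstance
  have hG : Nat.card (SpecialLinearGroup (Fin 2) R) = Nat.card (SpecialLinearGroup (Fin 2) R') := by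
    rw [← MonoidAlgebra.finrank_eq_card, ← MonoidAlgebra.finrank_eq_card,
      φ.toLinearEquiv.finrank_eq]
  have hs := Set.toFinite {χ : Rˣ →* ℂˣ | IsPrimitiveChar π (2 * r) χ}
  have ht := Set.toFinite {χ : R'ˣ →* ℂˣ | IsPrimitiveChar π' (2 * r) χ ∧ χ ≠ χ⁻¹}
  rw [Set.ncard_eq_toFinset_card _ hs, Set.ncard_eq_toFinset_card _ ht]
  refine Nat.le_of_mul_le_mul_right (Finset.card_mul_le_card_mul (m := 2) (n := 2)
    (fun χ χ' => ∃ a, principalIdem χ' * a * φ (principalIdem χ) ≠ 0) ?_ ?_) two_pos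
  · intro χ hχ
    rw [Set.Finite.mem_toFinset] at hχ
    obtain ⟨χ', hχ', hne', h1, h2⟩ := exists_primitive_of_isMinimalIdempotent hR'
      ((principalIdem_isMinimal hR hχ (hne χ hχ)).map φ) (by
        rw [AlgEquiv.finrank_range_mulRight, ← hG, ← hB]
        exact charIdem.card_le_finrank_range _ _)
    refine (Finset.card_pair hne').ge.trans (Finset.card_le_card fun x hx => ?_)
    rw [Finset.mem_bipartiteAbove, Set.Finite.mem_toFinset]
    rcases Finset.mem_insert.1 hx with rfl | hx
    · exact ⟨⟨hχ', hne'⟩, h1⟩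
    · obtain rfl := Finset.mem_singleton.1 hx
      exact ⟨⟨hχ'.inv, fun h => hne' (inv_injective h)⟩, h2⟩
  · intro χ' hχ'
    rw [Set.Finite.mem_toFinset] at hχ'
    rcases Finset.eq_empty_or_nonempty (hs.toFinset.bipartiteBelow
      (fun χ χ' => ∃ a, principalIdem χ' * a * φ (principalIdem χ) ≠ 0) χ') with h | ⟨χ, hχ⟩
    · rw [h]
      simp
    refine (Finset.card_le_card (t := {χ, χ⁻¹}) fun x hx => ?_).trans Finset.card_le_two
    rw [Finset.mem_bipartiteBelow, Set.Finite.mem_toFinset] at hχ hx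
    obtain ⟨hχ, a, ha⟩ := hχ
    obtain ⟨hx, b, hb⟩ := hx
    obtain ⟨c, hc⟩ := (principalIdem_isMinimal hR' hχ'.1 hχ'.2).exists_mul_mul_ne_zero hb ha
    rw [Finset.mem_insert, Finset.mem_singleton]
    by_contra! hcon
    apply hc
    have := congrArg φ (principalIdem_mul_mul_eq_zero hR hx hcon.1 hcon.2 (φ.symm c))
    simpa using this

/-- The group algebras of `SL₂` over two finite chain rings of the same even length and cardinality
are not isomorphic if the last layer of units consists of squares in only one of them. -/
theorem isEmpty_algEquiv (hR : IsChainRing res π (2 * r)) (hR' : IsChainRing res' π' (2 * r))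
    (hk : Nat.card k = Nat.card k') (hRR' : Nat.card R = Nat.card R')
    (hsq : ∀ u ∈ principalUnits (π ^ (2 * r - 1)), IsSquare u) {u : R'ˣ}
    (hu : u ∈ principalUnits (π' ^ (2 * r - 1))) (hnsq : ¬ IsSquare u) :
    IsEmpty (MonoidAlgebra ℂ (SpecialLinearGroup (Fin 2) R) ≃ₐ[ℂ]
      MonoidAlgebra ℂ (SpecialLinearGroup (Fin 2) R')) := by
  constructor
  intro φ
  have hr := hR.pos
  have : Finite k := hR.finite_residue
  have hk0 : 0 < Nat.card k := Nat.card_pos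
  have hU : Nat.card Rˣ = Nat.card R'ˣ := by
    have h1 := hR.card_mul_card_units
    have h2 := hR'.card_mul_card_units
    rw [← hk, ← hRR', ← h1] at h2
    exact (Nat.eq_of_mul_eq_mul_left hk0 (Nat.add_right_cancel h2)).symm
  have hB : Nat.card (borel R) = Nat.card (borel R') := by rw [card_borel, card_borel, hU, hRR']
  have h1 := card_primitiveChar_le hR hR' φ hB fun χ hχ => hχ.ne_inv hsq
  have h2 : {χ : R'ˣ →* ℂˣ | IsPrimitiveChar π' (2 * r) χ ∧ χ ≠ χ⁻¹}.ncard <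
      {χ : R'ˣ →* ℂˣ | IsPrimitiveChar π' (2 * r) χ}.ncard := by
    have : Finite (R'ˣ →* ℂˣ) := inferInstance
    refine Set.ncard_lt_ncard ⟨fun χ hχ => hχ.1, fun hle => ?_⟩ (Set.toFinite _)
    obtain ⟨χ, hχ, hχ'⟩ := IsPrimitiveChar.exists_eq_inv hu hnsq
    exact (hle hχ).2 hχ'
  have h3 := hR.card_primitiveChar_mul_add (by omega)
  have h4 := hR'.card_primitiveChar_mul_add (by omega)
  rw [← hk, ← hU, ← h3] at h4
  exact (h1.trans_lt h2).ne (Nat.eq_of_mul_eq_mul_right hk0 (Nat.add_right_cancel h4)).symm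

end SL2

/-! ### Squares in the last layer of units -/

namespace IsChainRing

variable {R k : Type*} [CommRing R] [Field k] {res : R →+* k} {π : R} {r : ℕ}

/-- In low ramification, the units close to `1` are squares. -/
theorem isSquare_of_mem_principalUnits (hR : IsChainRing res π (2 * r)) {e : ℕ} (he : e < r)
    {v : Rˣ} (h2 : (2 : R) = π ^ e * v) {u : Rˣ} (hu : u ∈ principalUnits (π ^ (2 * r - 1))) :
    IsSquare u := by
  obtain ⟨c, hc⟩ := hu
  rw [sub_eq_iff_eq_add] at hc
  -- A first-order square root: dividing by 2 lowers the exponent by `e`, and `e < r` gives `2 * (2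
  -- * r - 1 - e) ≥ 2 * r`, so the quadratic term vanishes.
  have hsq : (1 + (v⁻¹ : Rˣ) * c * π ^ (2 * r - 1 - e)) * (1 + (v⁻¹ : Rˣ) * c * π ^ (2 * r - 1 - e)) =
      (u : R) := by
    have h3 : π ^ (2 * r - 1) = π ^ e * π ^ (2 * r - 1 - e) := by
      rw [← pow_add]
      congr 1
      omega
    have h4 : π ^ (2 * r - 1 - e) * π ^ (2 * r - 1 - e) = 0 := by
      rw [← pow_add, hR.pow_eq_zero_iff]
      omega
    rw [hc, h3]
    linear_combination ((v⁻¹ : Rˣ) * c) ^ 2 * h4 + (v⁻¹ : Rˣ) * c * π ^ (2 * r - 1 - e) * h2 +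
      π ^ e * c * π ^ (2 * r - 1 - e) * v.inv_mul
  obtain ⟨y, hy⟩ := isUnit_of_mul_isUnit_left (hsq ▸ u.isUnit)
  refine ⟨y, ?_⟩
  ext
  rw [Units.val_mul, hy, hsq]

/-- In characteristic two, an odd power of the uniformizer gives a nonsquare. -/
theorem not_isSquare_of_two_eq_zero (hR : IsChainRing res π (2 * r)) (h2 : (2 : R) = 0) {u : Rˣ}
    (hu : (u : R) = 1 + π ^ (2 * r - 1)) : ¬ IsSquare u := by
  rintro ⟨y, rfl⟩
  have hr := hR.pos
  rw [Units.val_mul] at hu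
  -- In characteristic two a square root of `1 + π ^ (2 * r - 1)` would make this odd power of `π`
  -- itself a square, which the parity of exponents forbids.
  have hz : ((y : R) - 1) * (y - 1) = π ^ (2 * r - 1) := by
    linear_combination hu + (1 - (y : R)) * h2
  apply hR.pow_pred_ne_zero
  rcases hR.pow_dvd_or ((y : R) - 1) r with ⟨w, hw⟩ | ⟨i, hi, w, hw⟩
  · rw [← hz, hw, show π ^ r * w * (π ^ r * w) = π ^ (r + r) * (w * w) by ring, ← two_mul,
      hR.pow_eq_zero, zero_mul]
  · rw [hw] at hz
    have h3 : π ^ (2 * r - 1) * (w * w : Rˣ) = 0 := by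
      rw [show 2 * r - 1 = i + i + (2 * r - 1 - 2 * i) by omega, pow_add, pow_add, Units.val_mul,
        show π ^ i * π ^ i * π ^ (2 * r - 1 - 2 * i) * ((w : R) * w) =
          π ^ (2 * r - 1 - 2 * i) * (π ^ i * w * (π ^ i * w)) by ring, hz, ← pow_add,
        hR.pow_eq_zero_iff]
      omega
    exact (Units.mul_left_eq_zero _).1 h3

end IsChainRing

/-! ### Quotients of discrete valuation rings -/

section DiscreteValuationRing

variable {O : Type*} [CommRing O] [IsDomain O] [IsDiscreteValuationRing O]

theorem IsDiscreteValuationRing.isChainRing {ϖ : O} (hϖ : Irreducible ϖ) {m : ℕ} (hm : 0 < m) :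
    IsChainRing (Ideal.Quotient.lift (IsLocalRing.maximalIdeal O ^ m) (IsLocalRing.residue O) fun a ha =>
      (IsLocalRing.residue_eq_zero_iff a).2 (Ideal.pow_le_self hm.ne' ha))
      (Ideal.Quotient.mk (IsLocalRing.maximalIdeal O ^ m) ϖ) m where
  surjective := Ideal.Quotient.lift_surjective_of_surjective _ _ IsLocalRing.residue_surjective
  map_eq_zero_iff x := by
    obtain ⟨x, rfl⟩ := Ideal.Quotient.mk_surjective x
    have hϖ0 : IsLocalRing.residue O ϖ = 0 := by
      rw [IsLocalRing.residue_eq_zero_iff, hϖ.maximalIdeal_eq]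
      exact Ideal.mem_span_singleton_self ϖ
    constructor
    · intro h
      rw [Ideal.Quotient.lift_mk, IsLocalRing.residue_eq_zero_iff, hϖ.maximalIdeal_eq,
        Ideal.mem_span_singleton] at h
      exact map_dvd _ h
    · rintro ⟨y, hy⟩
      rw [hy, map_mul, Ideal.Quotient.lift_mk, hϖ0, zero_mul]
  isUnit x hx := by
    obtain ⟨x, rfl⟩ := Ideal.Quotient.mk_surjective x
    rw [Ideal.Quotient.lift_mk, IsLocalRing.residue_ne_zero_iff_isUnit] at hx
    exact hx.map _
  pow_eq_zero := by
    rw [← map_pow, Ideal.Quotient.eq_zero_iff_mem]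
    refine Ideal.pow_mem_pow ?_ m
    rw [hϖ.maximalIdeal_eq]
    exact Ideal.mem_span_singleton_self ϖ
  pow_pred_ne_zero := by
    rw [← map_pow, Ne, Ideal.Quotient.eq_zero_iff_mem, hϖ.maximalIdeal_eq,
      Ideal.span_singleton_pow, Ideal.mem_span_singleton, pow_dvd_pow_iff hϖ.ne_zero hϖ.not_isUnit]
    omega

/-- The powers of `I` are open, so compactness leaves finitely many cosets. -/
theorem IsAdic.finite_quotient_pow {A : Type*} [CommRing A] [TopologicalSpace A] [CompactSpace A]
    {I : Ideal A} (hI : IsAdic I) (m : ℕ) : Finite (A ⧸ I ^ m) := by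
  have : IsTopologicalRing A := by
    rw [IsAdic] at hI
    rw [hI]
    exact I.ringFilterBasis.isTopologicalRing
  exact AddSubgroup.quotient_finite_of_isOpen (I ^ m).toAddSubgroup ((isAdic_iff.1 hI).1 m)

theorem IsDiscreteValuationRing.card_quotient_pow (m : ℕ) :
    Nat.card (O ⧸ IsLocalRing.maximalIdeal O ^ m) = Nat.card (IsLocalRing.ResidueField O) ^ m :=
  cardQuot_pow_of_prime (IsDiscreteValuationRing.not_a_field O)

theorem IsDiscreteValuationRing.exists_eq_pow_mul_of_span_eq {ϖ x : O} (hϖ : Irreducible ϖ) {e : ℕ}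
    (h : Ideal.span {x} = IsLocalRing.maximalIdeal O ^ e) : ∃ v : Oˣ, x = ϖ ^ e * v := by
  rw [hϖ.maximalIdeal_eq, Ideal.span_singleton_pow, Ideal.span_singleton_eq_span_singleton] at h
  obtain ⟨v, hv⟩ := h.symm
  exact ⟨v, hv.symm⟩

end DiscreteValuationRing

theorem mainTheorem2
    {𝔬 : Type*} [CommRing 𝔬] [IsDomain 𝔬] [IsDiscreteValuationRing 𝔬]
    [TopologicalSpace 𝔬] [CompactSpace 𝔬] (h𝔬 : IsAdic (IsLocalRing.maximalIdeal 𝔬))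
    {𝔬' : Type*} [CommRing 𝔬'] [IsDomain 𝔬'] [IsDiscreteValuationRing 𝔬']
    [TopologicalSpace 𝔬'] [CompactSpace 𝔬'] (h𝔬' : IsAdic (IsLocalRing.maximalIdeal 𝔬'))
    (hres : Nonempty (IsLocalRing.ResidueField 𝔬 ≃+* IsLocalRing.ResidueField 𝔬'))
    (heven : 2 ∣ Nat.card (IsLocalRing.ResidueField 𝔬))
    [CharZero 𝔬] (e : ℕ)
    (he : Ideal.span {(2 : 𝔬)} = IsLocalRing.maximalIdeal 𝔬 ^ e)
    [CharP 𝔬' 2] (r : ℕ) (hr : e < r) :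
    IsEmpty
      (MonoidAlgebra ℂ
          (Matrix.SpecialLinearGroup (Fin 2) (𝔬 ⧸ IsLocalRing.maximalIdeal 𝔬 ^ (2 * r))) ≃ₐ[ℂ]
        MonoidAlgebra ℂ
          (Matrix.SpecialLinearGroup (Fin 2) (𝔬' ⧸ IsLocalRing.maximalIdeal 𝔬' ^ (2 * r)))) := by
  obtain ⟨ϖ, hϖ⟩ := IsDiscreteValuationRing.exists_irreducible 𝔬
  obtain ⟨ϖ', hϖ'⟩ := IsDiscreteValuationRing.exists_irreducible 𝔬'
  have := h𝔬.finite_quotient_pow (2 * r)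
  have := h𝔬'.finite_quotient_pow (2 * r)
  have hR := IsDiscreteValuationRing.isChainRing hϖ (m := 2 * r) (by omega)
  have hR' := IsDiscreteValuationRing.isChainRing hϖ' (m := 2 * r) (by omega)
  have hk := Nat.card_congr hres.some.toEquiv
  obtain ⟨v, hv⟩ := IsDiscreteValuationRing.exists_eq_pow_mul_of_span_eq hϖ he
  have h2 := congrArg (Ideal.Quotient.mk (IsLocalRing.maximalIdeal 𝔬 ^ (2 * r))) hv
  rw [map_mul, map_pow, map_ofNat] at h2
  have h2' := congrArg (Ideal.Quotient.mk (IsLocalRing.maximalIdeal 𝔬' ^ (2 * r)))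
    (CharTwo.two_eq_zero (R := 𝔬'))
  rw [map_ofNat, map_zero] at h2'
  obtain ⟨u, hu⟩ : IsUnit (1 + Ideal.Quotient.mk (IsLocalRing.maximalIdeal 𝔬' ^ (2 * r)) ϖ' ^
      (2 * r - 1)) := by
    rw [hR'.isUnit_iff, map_add, map_pow, (hR'.map_eq_zero_iff _).2 dvd_rfl, zero_pow (by omega)]
    simp
  exact SL2.isEmpty_algEquiv hR hR' hk
    (by rw [IsDiscreteValuationRing.card_quotient_pow, IsDiscreteValuationRing.card_quotient_pow,
      hk])
    (fun w hw => hR.isSquare_of_mem_principalUnits hr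
      (v := Units.map (Ideal.Quotient.mk _ : 𝔬 →+* _).toMonoidHom v) h2 hw)
    (by rw [mem_principalUnits, hu, add_sub_cancel_left]) (hR'.not_isSquare_of_two_eq_zero h2' hu)
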